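/- **Theorem (finite-time bounds for stochastic Gauss–Newton).** *Network.* For depth $H\ge 1$, width $m\ge 1$ and a $C^2$ activation $\sigma:\mathbb R\to\mathbb R$ with $\|\sigma\|_\infty\le\sigma_0$, $\|\sigma'\|_\infty\le\sigma_1$, $\|\sigma''\|_\infty\le\sigma_2$, let $w=\mathrm{vec}(W^{(1)},\dots,W^{(H)},c)\in\mathbb R^p$ with $W^{(1)}\in\mathbb R^{m\times d}$, $W^{(h)}\in\mathbb R^{m\times m}$ for $h\ge 2$, $c\in\mathbb R^m$, and set $x^{(0)}=x$, $x^{(h)}=\frac1{\sqrt m}\sigma(W^{(h)}x^{(h-1)})$ (coordinatewise), $\varphi(x;w)=c^\top x^{(H)}$. *Data and loss.* Let $z_j=(x_j,y_j)$, $j=1,\dots,n$, be any training set in a sample space $\mathcal X\times\mathcal Y\subset\mathbb R^d\times\mathbb R$ with $\|x_j\|_2\le1$ and $|y_j|\le 1$. Let $\nu>0$ and suppose that for every $z\in\mathcal X\times\mathcal Y$ the loss $y'\mapsto\ell(y',z)$ is twice differentiable, $\nu$-strongly convex, and $\beta_K$-Lipschitz on every compact $K\subset\mathbb R$, where $\beta_K>0$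 does not depend on $z$. Put $\widehat{\mathcal R}(w)=\frac1n\sum_{j=1}^n\ell(\varphi(x_j;w),z_j)$. *Constants.* Let $\mathcal C\subset\mathbb R^p$ be compact and convex with diameter $r_{\mathcal C}$ and let $w_0\in\mathcal C$. All suprema below are over $w\in\mathcal C$ and $\|x\|_2\le1$: $\mathrm{Lip}_{\varphi}=\sup\|\nabla_w\varphi(x;w)\|_2$, $\mathrm{Lip}_{\nabla\varphi}=\sup\|\nabla^2_w\varphi(x;w)\|_2$ (spectral norm), $M=\sup|\varphi(x;w)|$, and $\mathrm{Lip}_\ell=\beta_{[-M,M]}$. *Algorithm.* Let $1\le B\le n$ and let $I_0,I_1,\dots$ be i.i.d., uniform over the subsets of $\{1,\dots,n\}$ of size $B$. Let $\alpha,\lambda>0$ and $\eta\in\mathbb R$. With $J_k=[\nabla_w^\top\varphi(x_j;w_k)]_{j\in I_k}$ and $G_k=[\ell'(\varphi(x_j;w_k),z_j)]_{j\in I_k}$ ($\ell'$ is the derivative in the first argument), define $$H_k=\alpha\sum_{t=0}^kJ_t^\top J_t+\lambda I,\qquad u_k=w_k-\eta H_k^{-1}J_k^\top G_k,\qquad w_{k+1}=\arg\min_{u\in\mathcal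 C}\,(u-u_k)^\top H_k(u-u_k).$$ Let $\mathcal E(w)=\widehat{\mathcal R}(w)-\inf_{v\in\mathcal C}\widehat{\mathcal R}(v)$, $\xi=\eta/\alpha$ and $\gamma=\lambda/(\alpha\,\mathrm{Lip}_\varphi^2B)$ (with $\gamma:=0$ if $\mathrm{Lip}_\varphi=0$). *Claim.* Suppose $\xi\ge 2/\nu$. Then for every $k\ge1$ the random variables $\mathcal E(w_t)$ ($t<k$), $\mathcal E(\widehat w_k)$ with $\widehat w_k=\frac1k\sum_{t<k}w_t$, and $\log\frac{\det H_k}{\det H_0}$ are integrable, and $$\frac1k\sum_{t=0}^{k-1}\mathbb E[\mathcal E(w_t)]\le\kappa_{k,m}:=\frac1k\Big[\frac{\mathrm{Lip}_\varphi^2r_{\mathcal C}^2(\gamma+2)}{\xi}+\xi\,\mathrm{Lip}_\ell^2\Big(\mathbb E\log\frac{\det H_k}{\det H_0}+\frac1{\gamma+1}\Big)\Big]+\frac{r_{\mathcal C}^4\mathrm{Lip}_{\nabla\varphi}^2}{\xi}+\mathrm{Lip}_\ell\,r_{\mathcal C}^2\,\mathrm{Lip}_{\nabla\varphi},$$ $$\mathbb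 E[\mathcal E(\widehat w_k)]\le4\,\kappa_{k,m}+2\,r_{\mathcal C}^4\,\mathrm{Lip}_{\nabla\varphi}^2 .$$ Moreover $\mathrm{Lip}_{\nabla\varphi}^2\le K/m$, where $K\ge 0$ depends only on $H$, $\sigma_0,\sigma_1,\sigma_2$ and on upper bounds for $\max_h\|W^{(h)}_0\|_2/\sqrt m$, $\|c_0\|_2$ and $r_{\mathcal C}$; here $W_0^{(h)}$ and $c_0$ are the components of $w_0$. -/

import Mathlib

open MeasureTheory ProbabilityTheory

noncomputable section

namespace SGN

/-- A sample `z = (x, y)` with input `x ∈ ℝ^d` and label `y ∈ ℝ`. -/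
abbrev Sample (d : ℕ) : Type := EuclideanSpace ℝ (Fin d) × ℝ

/-- Coordinates of the parameter vector of a network of depth `H = L + 1` and width `m`:
the entries of `W⁽¹⁾ ∈ ℝ^{m×d}`, of the `L` matrices `W⁽²⁾, …, W⁽ᴸ⁺¹⁾ ∈ ℝ^{m×m}`, and of the
output layer `c ∈ ℝ^m`. -/
abbrev ParamIdx (d m L : ℕ) : Type :=
  (Fin m × Fin d) ⊕ (Fin L × Fin m × Fin m) ⊕ Fin m

/-- The parameter space `ℝ^p` with its Euclidean norm, `w = vec(W, c)`. -/
abbrev Param (d m L : ℕ) : Type := EuclideanSpace ℝ (ParamIdx d m L)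

/-- The first weight matrix `W⁽¹⁾`. -/
def weightIn {d m L : ℕ} (w : Param d m L) : Matrix (Fin m) (Fin d) ℝ :=
  Matrix.of fun i j => w (Sum.inl (i, j))

/-- The hidden weight matrices; `weightHid w h` is `W⁽ʰ⁺²⁾`, `h = 0, …, L - 1`. -/
def weightHid {d m L : ℕ} (w : Param d m L) (h : Fin L) : Matrix (Fin m) (Fin m) ℝ :=
  Matrix.of fun i j => w (Sum.inr (Sum.inl (h, i, j)))

/-- The output layer `c`. -/
def weightOut {d m L : ℕ} (w : Param d m L) : EuclideanSpace ℝ (Fin m) :=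
  WithLp.toLp 2 fun i => w (Sum.inr (Sum.inr i))

/-- One layer: `v ↦ (1/√m) σ(W v)`, with `σ` applied coordinatewise. -/
def layer {m q : ℕ} (σ : ℝ → ℝ) (W : Matrix (Fin m) (Fin q) ℝ) (v : Fin q → ℝ) : Fin m → ℝ :=
  fun i => (1 / √(m : ℝ)) * σ (W.mulVec v i)

/-- The hidden states: `hiddenState σ w x h` is `x⁽ʰ⁺¹⁾(W)`, `h = 0, …, L`. -/
def hiddenState {d m L : ℕ} (σ : ℝ → ℝ) (w : Param d m L) (x : EuclideanSpace ℝ (Fin d)) :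
    Fin (L + 1) → Fin m → ℝ :=
  Fin.induction (motive := fun _ => Fin m → ℝ) (layer σ (weightIn w) x)
    (fun h v => layer σ (weightHid w h) v)

/-- The network output `φ(x; w) = cᵀ x⁽ᴴ⁾(W)`, `H = L + 1`. -/
def net {d m L : ℕ} (σ : ℝ → ℝ) (x : EuclideanSpace ℝ (Fin d)) (w : Param d m L) : ℝ :=
  ∑ i, weightOut w i * hiddenState σ w x (Fin.last L) i

/-- The gradient `∇_w φ(x; w)`. -/
def gradNet {d m L : ℕ} (σ : ℝ → ℝ) (x : EuclideanSpace ℝ (Fin d)) (w : Param d m L) :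
    Param d m L :=
  gradient (net σ x) w

/-- The Hessian `∇²_w φ(x; w)`, as a linear operator on the parameter space. -/
def hessNet {d m L : ℕ} (σ : ℝ → ℝ) (x : EuclideanSpace ℝ (Fin d)) (w : Param d m L) :
    Param d m L →L[ℝ] Param d m L :=
  fderiv ℝ (gradNet σ x) w

/-- `sup |φ(x; w)|` over `w ∈ C` and `‖x‖₂ ≤ 1`. -/
def supNet {d m L : ℕ} (σ : ℝ → ℝ) (C : Set (Param d m L)) : ℝ :=
  sSup ((fun q : Param d m L × EuclideanSpace ℝ (Fin d) => |net σ q.2 q.1|) ''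
    (C ×ˢ Metric.closedBall 0 1))

/-- `Lip_{φ,C} = sup ‖∇_w φ(x; w)‖₂` over `w ∈ C` and `‖x‖₂ ≤ 1`. -/
def lipNet {d m L : ℕ} (σ : ℝ → ℝ) (C : Set (Param d m L)) : ℝ :=
  sSup ((fun q : Param d m L × EuclideanSpace ℝ (Fin d) => ‖gradNet σ q.2 q.1‖) ''
    (C ×ˢ Metric.closedBall 0 1))

/-- `Lip_{∇φ,C} = sup ‖∇²_w φ(x; w)‖₂` (spectral norm) over `w ∈ C` and `‖x‖₂ ≤ 1`. -/
def lipGrad {d m L : ℕ} (σ : ℝ → ℝ) (C : Set (Param d m L)) : ℝ :=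
  sSup ((fun q : Param d m L × EuclideanSpace ℝ (Fin d) => ‖hessNet σ q.2 q.1‖) ''
    (C ×ˢ Metric.closedBall 0 1))

open scoped Matrix.Norms.L2Operator in
/-- The spectral norm `‖M‖₂` of a real matrix. -/
def specNorm {a b : ℕ} (M : Matrix (Fin a) (Fin b) ℝ) : ℝ := ‖M‖

/-- `κ₀ = max_h ‖W⁽ʰ⁾‖₂ / √m`, the maximum over all `L + 1` weight matrices. -/
def kappaInit {d m L : ℕ} (w : Param d m L) : ℝ :=
  max (specNorm (weightIn w)) (⨆ h : Fin L, specNorm (weightHid w h)) / √(m : ℝ)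

/-- The activation is twice continuously differentiable with `‖σ‖_∞ ≤ σ₀`, `‖σ'‖_∞ ≤ σ₁`,
`‖σ''‖_∞ ≤ σ₂`. -/
structure IsActivation (σ : ℝ → ℝ) (σ₀ σ₁ σ₂ : ℝ) : Prop where
  smooth : ContDiff ℝ 2 σ
  bound : ∀ u, |σ u| ≤ σ₀
  bound_deriv : ∀ u, |deriv σ u| ≤ σ₁
  bound_deriv2 : ∀ u, |deriv (deriv σ) u| ≤ σ₂

/-- The loss assumption: for every sample `z ∈ 𝒵`, `y' ↦ ℓ(y', z)` is twice differentiable,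
`ν`-strongly convex, and `β K`-Lipschitz on every compact `K ⊆ ℝ`. -/
structure IsLoss {d : ℕ} (𝒵 : Set (Sample d)) (loss : ℝ → Sample d → ℝ) (ν : ℝ)
    (β : Set ℝ → ℝ) : Prop where
  differentiable : ∀ z ∈ 𝒵, Differentiable ℝ fun u => loss u z
  differentiable_deriv : ∀ z ∈ 𝒵, Differentiable ℝ (deriv fun u => loss u z)
  strongConvex : ∀ z ∈ 𝒵, StrongConvexOn Set.univ ν fun u => loss u z
  lip_pos : ∀ K : Set ℝ, IsCompact K → 0 < β K
  lip : ∀ K : Set ℝ, IsCompact K → ∀ z ∈ 𝒵, ∀ u ∈ K, ∀ v ∈ K,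
    |loss u z - loss v z| ≤ β K * |u - v|

/-- `I 0, I 1, …` are i.i.d., each uniformly distributed over the subsets of `{1, …, n}` of
size `B`. -/
structure IsUniformMinibatch {Ω : Type*} [MeasurableSpace Ω] (P : Measure Ω) {n : ℕ} (B : ℕ)
    (I : ℕ → Ω → Finset (Fin n)) : Prop where
  measurable : ∀ (k : ℕ) (M : Finset (Fin n)), MeasurableSet (I k ⁻¹' {M})
  indep : iIndepFun (m := fun _ => (⊤ : MeasurableSpace (Finset (Fin n)))) I P
  law : ∀ (k : ℕ) (M : Finset (Fin n)), M.card = B →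
    P (I k ⁻¹' {M}) = ((n.choose B : ℕ) : ENNReal)⁻¹

/-- The data of a run of stochastic Gauss-Newton (data only, no assumptions): the activation
`σ`, the loss, the training set `z`, the parameter set `C`, the initial parameter `w₀`, the batch
size `B`, and the hyperparameters `α`, `η` and `lam` (the damping factor `λ`). -/
structure Setup (d m L n : ℕ) where
  σ : ℝ → ℝ
  loss : ℝ → Sample d → ℝ
  z : Fin n → Sample d
  C : Set (Param d m L)
  w₀ : Param d m L
  B : ℕ
  α : ℝ
  η : ℝ
  lam : ℝ

/-- The squared seminorm `‖v‖²_M = vᵀ M v`. -/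
def sqNorm {ι : Type*} [Fintype ι] (M : Matrix ι ι ℝ) (v : EuclideanSpace ℝ ι) : ℝ :=
  v.ofLp ⬝ᵥ M.mulVec v.ofLp

/-- `v` is a minimizer of `‖v - u‖²_M` over `v ∈ C`. -/
def IsMetricProj {ι : Type*} [Fintype ι] (C : Set (EuclideanSpace ℝ ι)) (M : Matrix ι ι ℝ)
    (u v : EuclideanSpace ℝ ι) : Prop :=
  v ∈ C ∧ ∀ v' ∈ C, sqNorm M (v - u) ≤ sqNorm M (v' - u)

open Classical in
/-- The metric projection `π_C^M(u) = argmin_{v ∈ C} ‖v - u‖²_M` (equal to `u` if there is no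
minimizer, which does not happen for a nonempty compact `C`). -/
def metricProj {ι : Type*} [Fintype ι] (C : Set (EuclideanSpace ℝ ι)) (M : Matrix ι ι ℝ)
    (u : EuclideanSpace ℝ ι) : EuclideanSpace ℝ ι :=
  if h : ∃ v, IsMetricProj C M u v then h.choose else u

theorem isMetricProj_metricProj {ι : Type*} [Fintype ι] {C : Set (EuclideanSpace ℝ ι)}
    (hC : IsCompact C) (hne : C.Nonempty) (M : Matrix ι ι ℝ) (u : EuclideanSpace ℝ ι) :
    IsMetricProj C M u (metricProj C M u) := by
  have h : ∃ v, IsMetricProj C M u v := by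
    have hc : ContinuousOn (fun v : EuclideanSpace ℝ ι => sqNorm M (v - u)) C := by
      refine Continuous.continuousOn ?_
      unfold sqNorm dotProduct Matrix.mulVec dotProduct
      fun_prop
    obtain ⟨v, hv, hmin⟩ := hC.exists_isMinOn hne hc
    exact ⟨v, hv, fun v' hv' => hmin hv'⟩
  unfold metricProj
  rw [dif_pos h]
  exact h.choose_spec

namespace Setup

variable {d m L n : ℕ}

/-- The empirical risk `R̂_S(φ(w)) = (1/n) ∑_j ℓ(φ(x_j; w), z_j)`. -/
def risk (s : Setup d m L n) (w : Param d m L) : ℝ :=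
  (1 / (n : ℝ)) * ∑ j, s.loss (net s.σ (s.z j).1 w) (s.z j)

/-- The optimality gap `ℰ(w) = R̂_S(φ(w)) - inf_{v ∈ C} R̂_S(φ(v))`. -/
def gap (s : Setup d m L n) (w : Param d m L) : ℝ :=
  s.risk w - sInf (s.risk '' s.C)

/-- The Jacobian `[∇_wᵀ φ(x_j; w)]_{j ∈ I}` of the predictor on the mini-batch `I`. -/
def jac (s : Setup d m L n) (I : Finset (Fin n)) (w : Param d m L) :
    Matrix {j // j ∈ I} (ParamIdx d m L) ℝ :=
  Matrix.of fun j i => gradNet s.σ (s.z j).1 w i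

/-- The loss derivatives `[ℓ'(φ(x_j; w); z_j)]_{j ∈ I}` on the mini-batch `I`. -/
def lossGrad (s : Setup d m L n) (I : Finset (Fin n)) (w : Param d m L) : {j // j ∈ I} → ℝ :=
  fun j => deriv (fun u => s.loss u (s.z j)) (net s.σ (s.z j).1 w)

/-- The mini-batch gradient `Ψ = Jᵀ G`. -/
def batchGrad (s : Setup d m L n) (I : Finset (Fin n)) (w : Param d m L) :
    ParamIdx d m L → ℝ :=
  (s.jac I w).transpose.mulVec (s.lossGrad I w)

/-- The state before step `k` along the batches `I`: the pair `(w_k, H_{k-1})`, where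
`H_{-1} = λ I`. Step `k` sets `H_k = H_{k-1} + α J_kᵀ(w_k) J_k(w_k)`,
`u_k = w_k - η H_k⁻¹ Ψ_k(w_k)` and `w_{k+1} = π_C^{H_k}(u_k)`. -/
def state (s : Setup d m L n) (I : ℕ → Finset (Fin n)) :
    ℕ → Param d m L × Matrix (ParamIdx d m L) (ParamIdx d m L) ℝ
  | 0 => (s.w₀, s.lam • 1)
  | k + 1 =>
    let w := (s.state I k).1
    let Hk := (s.state I k).2 + s.α • ((s.jac (I k) w).transpose * s.jac (I k) w)
    (metricProj s.C Hk (w - s.η • WithLp.toLp 2 (Hk⁻¹.mulVec (s.batchGrad (I k) w))), Hk)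

/-- The iterate `w_k`. -/
def iter (s : Setup d m L n) (I : ℕ → Finset (Fin n)) (k : ℕ) : Param d m L :=
  (s.state I k).1

/-- The preconditioner `H_k`. -/
def precond (s : Setup d m L n) (I : ℕ → Finset (Fin n)) (k : ℕ) :
    Matrix (ParamIdx d m L) (ParamIdx d m L) ℝ :=
  (s.state I (k + 1)).2

/-- `H_k = α ∑_{t=0}^k J_tᵀ(w_t) J_t(w_t) + λ I`. -/
theorem precond_eq (s : Setup d m L n) (I : ℕ → Finset (Fin n)) (k : ℕ) :
    s.precond I k =
      s.α • (∑ t ∈ Finset.range (k + 1),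
        (s.jac (I t) (s.iter I t)).transpose * s.jac (I t) (s.iter I t)) + s.lam • 1 := by
  induction k with
  | zero => simp [precond, iter, state, add_comm]
  | succ k ih =>
    rw [Finset.sum_range_succ, smul_add, add_right_comm, ← ih]
    rfl

/-- `w_{k+1} = π_C^{H_k}(w_k - η H_k⁻¹ Ψ_k(w_k))`. -/
theorem iter_succ (s : Setup d m L n) (I : ℕ → Finset (Fin n)) (k : ℕ) :
    s.iter I (k + 1) =
      metricProj s.C (s.precond I k)
        (s.iter I k -
          s.η • WithLp.toLp 2 ((s.precond I k)⁻¹.mulVec (s.batchGrad (I k) (s.iter I k)))) :=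
  rfl

/-- The Polyak-Ruppert average `ŵ_k = (1/k) ∑_{t<k} w_t`. -/
def avgIter (s : Setup d m L n) (I : ℕ → Finset (Fin n)) (k : ℕ) : Param d m L :=
  (1 / (k : ℝ)) • ∑ t ∈ Finset.range k, s.iter I t

/-- `log (det H_k / det H_0)`. -/
def logDet (s : Setup d m L n) (I : ℕ → Finset (Fin n)) (k : ℕ) : ℝ :=
  Real.log ((s.precond I k).det / (s.precond I 0).det)

/-- `Lip_{ℓ,C} = β_K` for `K = [-M, M]`, `M = sup |φ(x; w)|` over `w ∈ C` and `‖x‖₂ ≤ 1`. -/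
def lipLoss (s : Setup d m L n) (β : Set ℝ → ℝ) : ℝ :=
  β (Set.Icc (-supNet s.σ s.C) (supNet s.σ s.C))

/-- `ξ = η / α`. -/
def xi (s : Setup d m L n) : ℝ := s.η / s.α

/-- `γ = λ / (α Lip_{φ,C}² B)`. -/
def gamma (s : Setup d m L n) : ℝ := s.lam / (s.α * lipNet s.σ s.C ^ 2 * s.B)

/-- The bound `κ_{k,m}`, where `Lℓ` stands for `Lip_{ℓ,C}` and `D` for
`𝔼 log (det H_k / det H_0)`. -/
def kappa (s : Setup d m L n) (Lℓ D : ℝ) (k : ℕ) : ℝ :=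
  (1 / (k : ℝ)) *
      (lipNet s.σ s.C ^ 2 * Metric.diam s.C ^ 2 * (s.gamma + 2) / s.xi
        + s.xi * Lℓ ^ 2 * (D + 1 / (s.gamma + 1)))
    + Metric.diam s.C ^ 4 * lipGrad s.σ s.C ^ 2 / s.xi
    + Lℓ * Metric.diam s.C ^ 2 * lipGrad s.σ s.C

end Setup

end SGN

end

/-! Fix the batches and a point `v` of `C`. For one sample let `a = ⟨∇φ(w), v - w⟩`, `δ = φ(v) -
φ(w)`, `g = ℓ'(φ(w))` and `E = Lip_∇φ r_C²`, so that `|δ - a| ≤ E`. Strong convexity gives `ℓ(v) -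
ℓ(w) ≥ gδ + (ν/2)δ²`. Since `2α ≤ ην`, the quadratic gain pays for `αa² ≤ 2αδ² + 2αE²`
(`Regular.sample_le`). The sum of `αa²` over the batch is exactly what `‖v - w‖²` gains when the
metric grows from `H_{k-1}` to `H_k`. As the projection in the metric `H_k` does not increase the
distance to `v`, the potential `‖v - w_k‖²`, measured in `H_{k-1}`, telescopes from `λ‖v - w₀‖²`
(`Regular.telescope`). The regret is then paid for by linearization errors and by `η² ∑ Ψᵀ H_k⁻¹ Ψ`.

That last sum is an elliptical potential: `Ψ = JᵀG`, and `α tr(J H⁻¹ Jᵀ)` is at most the increment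
of `log det` (`mul_trace_gram_inv_le_log_det`). The log-determinant is measured from `H_0`, so step
`0` needs a separate estimate, which produces `1/(γ+1)`.

For the expectation, `v` is a minimizer of the risk on `C`. The iterate `w_t` is a function of the
batches before `t`, hence independent of `I_t`, so the batch regret at step `t` has mean `B · 𝔼
ℰ(w_t)` (`integral_sum_mem`). Dividing by `2ηBk` gives a bound below `κ`. For the average, linearize
at `ŵ_k`, where the first-order terms cancel: averaging costs at most `Lip_ℓ E`, itself a summand of
`κ`, so `2κ` already suffices.

The width estimate follows value, first and second derivative through the layers (`JetBound`).
Weight norms are `O(√m)`, each layer divides by `√m`, and the derivatives of a coordinatewise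
activation carry no dimension factor, so hidden states have derivatives `O(1/√m)`. Every term of the
Hessian of `φ` contains such a derivative. -/

noncomputable section

set_option maxSynthPendingDepth 3

namespace SGN

/-! ### Calculus of value, first and second derivative bounds -/

section Jet

variable {E F G : Type*} [NormedAddCommGroup E] [NormedSpace ℝ E] [NormedAddCommGroup F]
  [NormedSpace ℝ F] [NormedAddCommGroup G] [NormedSpace ℝ G]

/-- `f` is `C²`, and its value and first two derivatives at `x` are bounded by `b₀`, `b₁`, `b₂`. -/
structure JetBound (f : E → F) (x : E) (b₀ b₁ b₂ : ℝ) : Prop where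
  contDiff : ContDiff ℝ 2 f
  value : ‖f x‖ ≤ b₀
  deriv : ‖fderiv ℝ f x‖ ≤ b₁
  deriv2 : ‖fderiv ℝ (fderiv ℝ f) x‖ ≤ b₂

theorem norm_iteratedFDeriv_two (f : E → F) (x : E) :
    ‖iteratedFDeriv ℝ 2 f x‖ = ‖fderiv ℝ (fderiv ℝ f) x‖ := by
  rw [← norm_iteratedFDeriv_one, norm_iteratedFDeriv_fderiv]

theorem JetBound.mono {f : E → F} {x : E} {a₀ a₁ a₂ b₀ b₁ b₂ : ℝ} (h : JetBound f x a₀ a₁ a₂)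
    (h₀ : a₀ ≤ b₀) (h₁ : a₁ ≤ b₁) (h₂ : a₂ ≤ b₂) : JetBound f x b₀ b₁ b₂ :=
  ⟨h.contDiff, h.value.trans h₀, h.deriv.trans h₁, h.deriv2.trans h₂⟩

theorem JetBound.const (c : F) (x : E) {b : ℝ} (h : ‖c‖ ≤ b) :
    JetBound (fun _ : E => c) x b 0 0 := by
  refine ⟨contDiff_const, h, by simp, ?_⟩
  rw [← norm_iteratedFDeriv_two, iteratedFDeriv_const_of_ne (by norm_num)]
  simp

theorem JetBound.clm (T : E →L[ℝ] F) (x : E) {b₀ b₁ : ℝ} (h₀ : ‖T x‖ ≤ b₀) (h₁ : ‖T‖ ≤ b₁) :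
    JetBound T x b₀ b₁ 0 := by
  refine ⟨T.contDiff, h₀, by simpa using h₁, ?_⟩
  have : fderiv ℝ (T : E → F) = fun _ => T := by ext1 y; simp
  rw [this]
  simp

/-- Leibniz rule for the bilinear pairing of `A` and `f`. It serves both the pre-activations `W x`
and the output `⟨c, x⟩`. -/
theorem JetBound.clm_apply {A : E → F →L[ℝ] G} {f : E → F} {x : E} {a₀ a₁ a₂ b₀ b₁ b₂ : ℝ}
    (hA : JetBound A x a₀ a₁ a₂) (hf : JetBound f x b₀ b₁ b₂) :
    JetBound (fun y => A y (f y)) x (a₀ * b₀) (a₀ * b₁ + a₁ * b₀)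
      (a₀ * b₂ + 2 * (a₁ * b₁) + a₂ * b₀) := by
  have ha₀ := (norm_nonneg _).trans hA.value
  have ha₁ := (norm_nonneg _).trans hA.deriv
  have ha₂ := (norm_nonneg _).trans hA.deriv2
  refine ⟨hA.contDiff.clm_apply hf.contDiff, ?_, ?_, ?_⟩
  · exact ((A x).le_opNorm _).trans (mul_le_mul hA.value hf.value (norm_nonneg _) ha₀)
  · rw [← norm_iteratedFDeriv_one]
    refine (norm_iteratedFDeriv_clm_apply hA.contDiff hf.contDiff x (by norm_num)).trans ?_
    simp only [Finset.sum_range_succ, Finset.sum_range_zero, norm_iteratedFDeriv_one,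
      Nat.choose_zero_right, Nat.choose_self, Nat.sub_zero, Nat.cast_one, one_mul, zero_add,
      norm_iteratedFDeriv_zero]
    change _ + _ * ‖iteratedFDeriv ℝ 0 f x‖ ≤ _
    rw [norm_iteratedFDeriv_zero]
    exact add_le_add (mul_le_mul hA.value hf.deriv (norm_nonneg _) ha₀)
      (mul_le_mul hA.deriv hf.value (norm_nonneg _) ha₁)
  · rw [← norm_iteratedFDeriv_two]
    refine (norm_iteratedFDeriv_clm_apply hA.contDiff hf.contDiff x (by norm_num)).trans ?_
    simp only [Finset.sum_range_succ, Finset.sum_range_zero, norm_iteratedFDeriv_one,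
      norm_iteratedFDeriv_zero, norm_iteratedFDeriv_two, Nat.choose_zero_right, Nat.choose_self,
      Nat.sub_zero, Nat.cast_one, one_mul, zero_add, Nat.choose_one_right,
      Nat.cast_ofNat]
    change _ + _ * ‖iteratedFDeriv ℝ 1 f x‖ + _ * ‖iteratedFDeriv ℝ 0 f x‖ ≤ _
    rw [norm_iteratedFDeriv_zero, norm_iteratedFDeriv_one]
    have := mul_le_mul hA.value hf.deriv2 (norm_nonneg _) ha₀
    have := mul_le_mul hA.deriv hf.deriv (norm_nonneg _) ha₁
    have := mul_le_mul hA.deriv2 hf.value (norm_nonneg _) ha₂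
    linarith

theorem JetBound.const_smul {f : E → F} {x : E} {b₀ b₁ b₂ : ℝ} (c : ℝ) (hc : 0 ≤ c)
    (h : JetBound f x b₀ b₁ b₂) :
    JetBound (fun y => c • f y) x (c * b₀) (c * b₁) (c * b₂) := by
  have h1 : fderiv ℝ (fun y => c • f y) = fun y => c • fderiv ℝ f y := by
    ext1 y
    exact fderiv_const_smul (h.contDiff.differentiable (by norm_num) y) c
  have h2 : fderiv ℝ (fun y => c • fderiv ℝ f y) x = c • fderiv ℝ (fderiv ℝ f) x :=
    fderiv_const_smul ((h.contDiff.fderiv_right (m := 1) (by norm_num)).differentiable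
      (by norm_num) x) c
  refine ⟨contDiff_const.smul h.contDiff, ?_, ?_, ?_⟩
  · rw [norm_smul, Real.norm_of_nonneg hc]
    exact mul_le_mul_of_nonneg_left h.value hc
  · rw [h1, norm_smul, Real.norm_of_nonneg hc]
    exact mul_le_mul_of_nonneg_left h.deriv hc
  · rw [h1, h2, norm_smul, Real.norm_of_nonneg hc]
    exact mul_le_mul_of_nonneg_left h.deriv2 hc

/-- The product rule for operator composition; differentiating the chain rule `Dg(f y) ∘ Df(y)` once
more requires it. -/
theorem norm_fderiv_clm_comp_le {A : E → F →L[ℝ] G} {T : E → E →L[ℝ] F} (hA : ContDiff ℝ 1 A)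
    (hT : ContDiff ℝ 1 T) (x : E) :
    ‖fderiv ℝ (fun y => (A y).comp (T y)) x‖
      ≤ ‖A x‖ * ‖fderiv ℝ T x‖ + ‖fderiv ℝ A x‖ * ‖T x‖ := by
  have h := (ContinuousLinearMap.compL ℝ E F G).norm_iteratedFDeriv_le_of_bilinear_of_le_one
    hA hT x (n := 1) (by norm_num) (ContinuousLinearMap.norm_compL_le ℝ E F G)
  simpa [Finset.sum_range_succ, norm_iteratedFDeriv_one, norm_iteratedFDeriv_zero] using h

/-- Composition with a `C²` map `g` whose first two derivatives are globally bounded. -/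
theorem JetBound.comp {g : F → G} {f : E → F} {x : E} {b₀ b₁ b₂ s₀ s₁ s₂ : ℝ}
    (hg : ContDiff ℝ 2 g) (h₀ : ∀ y, ‖g y‖ ≤ s₀) (h₁ : ∀ y, ‖fderiv ℝ g y‖ ≤ s₁)
    (h₂ : ∀ y, ‖fderiv ℝ (fderiv ℝ g) y‖ ≤ s₂) (hf : JetBound f x b₀ b₁ b₂) :
    JetBound (fun y => g (f y)) x s₀ (s₁ * b₁) (s₂ * b₁ ^ 2 + s₁ * b₂) := by
  have hs₁ := (norm_nonneg _).trans (h₁ 0)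
  have hs₂ := (norm_nonneg _).trans (h₂ 0)
  have hb₁ := (norm_nonneg _).trans hf.deriv
  have hgd := hg.differentiable (by norm_num)
  have hfd := hf.contDiff.differentiable (by norm_num)
  have hg' : ContDiff ℝ 1 (fderiv ℝ g) := hg.fderiv_right (by norm_num)
  have hf' : ContDiff ℝ 1 (fderiv ℝ f) := hf.contDiff.fderiv_right (by norm_num)
  have e1 : fderiv ℝ (fun y => g (f y)) = fun y => (fderiv ℝ g (f y)).comp (fderiv ℝ f y) := by
    ext1 y
    exact fderiv_fun_comp y (hgd _) (hfd _)
  have hgf : ContDiff ℝ 1 fun y => fderiv ℝ g (f y) :=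
    hg'.comp (hf.contDiff.of_le (by norm_num))
  have e2 : fderiv ℝ (fun y => fderiv ℝ g (f y)) x
      = (fderiv ℝ (fderiv ℝ g) (f x)).comp (fderiv ℝ f x) :=
    fderiv_fun_comp x (hg'.differentiable (by norm_num) _) (hfd _)
  refine ⟨hg.comp hf.contDiff, h₀ _, ?_, ?_⟩
  · rw [e1]
    exact (ContinuousLinearMap.opNorm_comp_le _ _).trans
      (mul_le_mul (h₁ _) hf.deriv (norm_nonneg _) hs₁)
  · rw [e1]
    refine (norm_fderiv_clm_comp_le hgf hf' x).trans ?_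
    have k1 := mul_le_mul (h₁ (f x)) hf.deriv2 (norm_nonneg _) hs₁
    have k2 : ‖fderiv ℝ (fun y => fderiv ℝ g (f y)) x‖ ≤ s₂ * b₁ := by
      rw [e2]
      exact (ContinuousLinearMap.opNorm_comp_le _ _).trans
        (mul_le_mul (h₂ _) hf.deriv (norm_nonneg _) hs₂)
    have k3 := mul_le_mul k2 hf.deriv (norm_nonneg _) (mul_nonneg hs₂ hb₁)
    nlinarith

end Jet

/-! ### Coordinatewise maps -/

/-- Coordinatewise product, as a bounded bilinear map. -/
def diagMul (m : ℕ) : EuclideanSpace ℝ (Fin m) →L[ℝ] EuclideanSpace ℝ (Fin m) →L[ℝ]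
    EuclideanSpace ℝ (Fin m) :=
  LinearMap.toContinuousLinearMap
    (LinearMap.toContinuousLinearMap.toLinearMap ∘ₗ
      LinearMap.mk₂ ℝ (fun u v => WithLp.toLp 2 fun i => u i * v i)
        (fun _ _ _ => by ext i; simp [add_mul]) (fun _ _ _ => by ext i; simp [mul_assoc])
        (fun _ _ _ => by ext i; simp [mul_add]) (fun _ _ _ => by ext i; simp [mul_left_comm]))

@[simp]
theorem diagMul_apply {m : ℕ} (u v : EuclideanSpace ℝ (Fin m)) (i : Fin m) :
    diagMul m u v i = u i * v i := rfl

theorem norm_le_mul_of_abs_le {m : ℕ} {u v : EuclideanSpace ℝ (Fin m)} {c : ℝ} (hc : 0 ≤ c)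
    (h : ∀ i, |u i| ≤ c * |v i|) : ‖u‖ ≤ c * ‖v‖ := by
  refine le_of_sq_le_sq ?_ (mul_nonneg hc (norm_nonneg _))
  rw [mul_pow, EuclideanSpace.norm_sq_eq, EuclideanSpace.norm_sq_eq, Finset.mul_sum]
  refine Finset.sum_le_sum fun i _ => ?_
  rw [← mul_pow]
  exact pow_le_pow_left₀ (norm_nonneg _) (h i) 2

/-- A diagonal operator has norm at most its largest entry. This keeps the derivatives of a
coordinatewise activation free of factors growing with `m`. -/
theorem norm_diagMul_le {m : ℕ} {u : EuclideanSpace ℝ (Fin m)} {c : ℝ} (hc : 0 ≤ c)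
    (h : ∀ i, |u i| ≤ c) : ‖diagMul m u‖ ≤ c := by
  refine ContinuousLinearMap.opNorm_le_bound _ hc fun v => norm_le_mul_of_abs_le hc fun i => ?_
  rw [diagMul_apply, abs_mul]
  exact mul_le_mul_of_nonneg_right (h i) (abs_nonneg _)

/-- The coordinatewise application of a scalar function. -/
def actMap (m : ℕ) (σ : ℝ → ℝ) (v : EuclideanSpace ℝ (Fin m)) : EuclideanSpace ℝ (Fin m) :=
  WithLp.toLp 2 fun i => σ (v i)

theorem contDiff_actMap {m : ℕ} {σ : ℝ → ℝ} {N : WithTop ℕ∞} (h : ContDiff ℝ N σ) :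
    ContDiff ℝ N (actMap m σ) := by
  rw [contDiff_euclidean]
  intro i
  exact h.comp (EuclideanSpace.proj i : EuclideanSpace ℝ (Fin m) →L[ℝ] ℝ).contDiff

theorem hasFDerivAt_actMap {m : ℕ} {σ : ℝ → ℝ} (h : Differentiable ℝ σ)
    (v : EuclideanSpace ℝ (Fin m)) :
    HasFDerivAt (actMap m σ) (diagMul m (actMap m (deriv σ) v)) v := by
  rw [← hasFDerivWithinAt_univ, hasFDerivWithinAt_piLp]
  intro i
  rw [hasFDerivWithinAt_univ]
  have h1 := HasFDerivAt.comp (g := σ) v (h (v i)).hasDerivAt.hasFDerivAt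
    (EuclideanSpace.proj i : EuclideanSpace ℝ (Fin m) →L[ℝ] ℝ).hasFDerivAt
  refine h1.congr_fderiv (ContinuousLinearMap.ext fun u => ?_)
  simp [actMap, mul_comm]

theorem fderiv_actMap {m : ℕ} {σ : ℝ → ℝ} (h : Differentiable ℝ σ) :
    fderiv ℝ (actMap m σ) = fun v => diagMul m (actMap m (deriv σ) v) := by
  ext1 v
  exact (hasFDerivAt_actMap h v).fderiv

theorem norm_fderiv_actMap_le {m : ℕ} {σ : ℝ → ℝ} {c : ℝ} (h : Differentiable ℝ σ)
    (hc : ∀ u, |deriv σ u| ≤ c) (v : EuclideanSpace ℝ (Fin m)) :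
    ‖fderiv ℝ (actMap m σ) v‖ ≤ c := by
  rw [fderiv_actMap h]
  exact norm_diagMul_le ((abs_nonneg _).trans (hc 0)) fun i => hc _

/-- The second derivative sends `u` to the diagonal operator with entries `σ''(v i) * u i`, and `|u
i| ≤ ‖u‖`. -/
theorem norm_fderiv_fderiv_actMap_le {m : ℕ} {σ : ℝ → ℝ} {c : ℝ} (h : ContDiff ℝ 2 σ)
    (hc : ∀ u, |deriv (deriv σ) u| ≤ c) (v : EuclideanSpace ℝ (Fin m)) :
    ‖fderiv ℝ (fderiv ℝ (actMap m σ)) v‖ ≤ c := by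
  have hc0 := (abs_nonneg _).trans (hc 0)
  have hd : Differentiable ℝ (deriv σ) :=
    ((contDiff_succ_iff_deriv (n := 1)).1 h).2.2.differentiable (by norm_num)
  rw [fderiv_actMap (h.differentiable (by norm_num))]
  have h1 := (diagMul m).hasFDerivAt.comp v (hasFDerivAt_actMap hd v)
  have h2 : fderiv ℝ (fun v => diagMul m (actMap m (deriv σ) v)) v
      = (diagMul m).comp (diagMul m (actMap m (deriv (deriv σ)) v)) := h1.fderiv
  rw [h2]
  refine ContinuousLinearMap.opNorm_le_bound _ hc0 fun u => ?_
  refine norm_diagMul_le (mul_nonneg hc0 (norm_nonneg _)) fun i => ?_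
  refine (abs_mul _ _).trans_le ?_
  exact mul_le_mul (hc _) (PiLp.norm_apply_le u i) (abs_nonneg _) hc0

end SGN

namespace SGN

/-! ### Derivative bounds for the network -/

variable {d m L : ℕ}

/-- The operator on Euclidean spaces given by a matrix. -/
def matCLM {a b : ℕ} (M : Matrix (Fin a) (Fin b) ℝ) :
    EuclideanSpace ℝ (Fin b) →L[ℝ] EuclideanSpace ℝ (Fin a) :=
  (Matrix.toEuclideanLin (𝕜 := ℝ)).trans LinearMap.toContinuousLinearMap M

/-- The Frobenius norm dominates the operator norm, by Cauchy–Schwarz in each row. The Euclidean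
norm of the parameter controls Frobenius norms. -/
theorem norm_matCLM_le_of_sum_sq_le {a b : ℕ} (M : Matrix (Fin a) (Fin b) ℝ) {c : ℝ} (hc : 0 ≤ c)
    (h : ∑ i, ∑ j, M i j ^ 2 ≤ c ^ 2) : ‖matCLM M‖ ≤ c := by
  refine ContinuousLinearMap.opNorm_le_bound _ hc fun v => ?_
  refine le_of_sq_le_sq ?_ (mul_nonneg hc (norm_nonneg _))
  rw [mul_pow, EuclideanSpace.real_norm_sq_eq, EuclideanSpace.real_norm_sq_eq]
  calc ∑ i, (matCLM M v i) ^ 2 ≤ ∑ i, (∑ j, M i j ^ 2) * ∑ j, v j ^ 2 :=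
        Finset.sum_le_sum fun i _ => by
          change (∑ j, M i j * v j) ^ 2 ≤ _
          exact Finset.sum_mul_sq_le_sq_mul_sq _ _ _
    _ = (∑ i, ∑ j, M i j ^ 2) * ∑ j, v j ^ 2 := by rw [Finset.sum_mul]
    _ ≤ _ := mul_le_mul_of_nonneg_right h (Finset.sum_nonneg fun _ _ => sq_nonneg _)

/-- The first weight matrix as a linear function of the parameter. -/
def weightInCLM (d m L : ℕ) :
    Param d m L →L[ℝ] EuclideanSpace ℝ (Fin d) →L[ℝ] EuclideanSpace ℝ (Fin m) :=
  LinearMap.toContinuousLinearMap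
    { toFun := fun w => matCLM (weightIn w)
      map_add' := fun v w => by
        rw [show weightIn (v + w) = weightIn v + weightIn w from rfl]
        exact map_add _ _ _
      map_smul' := fun c w => by
        rw [show weightIn (c • w) = c • weightIn w from rfl]
        exact map_smul _ _ _ }

/-- A hidden weight matrix as a linear function of the parameter. -/
def weightHidCLM (d m L : ℕ) (h : Fin L) :
    Param d m L →L[ℝ] EuclideanSpace ℝ (Fin m) →L[ℝ] EuclideanSpace ℝ (Fin m) :=
  LinearMap.toContinuousLinearMap
    { toFun := fun w => matCLM (weightHid w h)
      map_add' := fun v w => by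
        rw [show weightHid (v + w) h = weightHid v h + weightHid w h from rfl]
        exact map_add _ _ _
      map_smul' := fun c w => by
        rw [show weightHid (c • w) h = c • weightHid w h from rfl]
        exact map_smul _ _ _ }

/-- The output layer as a linear function of the parameter. -/
def weightOutCLM (d m L : ℕ) : Param d m L →L[ℝ] EuclideanSpace ℝ (Fin m) :=
  LinearMap.toContinuousLinearMap
    { toFun := weightOut
      map_add' := fun _ _ => rfl
      map_smul' := fun _ _ => rfl }

theorem norm_sq_param (w : Param d m L) :
    ‖w‖ ^ 2 = ∑ i, ∑ j, weightIn w i j ^ 2 + (∑ h, ∑ i, ∑ j, weightHid w h i j ^ 2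
      + ∑ i, weightOut w i ^ 2) := by
  rw [EuclideanSpace.real_norm_sq_eq, Fintype.sum_sum_type, Fintype.sum_sum_type,
    Fintype.sum_prod_type, Fintype.sum_prod_type]
  simp only [Fintype.sum_prod_type]
  rfl

theorem norm_weightInCLM_apply_le (w : Param d m L) : ‖weightInCLM d m L w‖ ≤ ‖w‖ := by
  refine norm_matCLM_le_of_sum_sq_le _ (norm_nonneg _) ?_
  rw [norm_sq_param]
  have : 0 ≤ ∑ h, ∑ i, ∑ j, weightHid w h i j ^ 2 := by positivity
  have : 0 ≤ ∑ i, weightOut w i ^ 2 := by positivity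
  linarith

theorem norm_weightHidCLM_apply_le (h : Fin L) (w : Param d m L) :
    ‖weightHidCLM d m L h w‖ ≤ ‖w‖ := by
  refine norm_matCLM_le_of_sum_sq_le _ (norm_nonneg _) ?_
  rw [norm_sq_param]
  have h1 : 0 ≤ ∑ i, ∑ j, weightIn w i j ^ 2 := by positivity
  have h2 : 0 ≤ ∑ i, weightOut w i ^ 2 := by positivity
  have h3 : ∑ i, ∑ j, weightHid w h i j ^ 2 ≤ ∑ h, ∑ i, ∑ j, weightHid w h i j ^ 2 :=
    Finset.single_le_sum (f := fun h => ∑ i, ∑ j, weightHid w h i j ^ 2)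
      (fun _ _ => by positivity) (Finset.mem_univ h)
  linarith

theorem norm_weightOutCLM_apply_le (w : Param d m L) : ‖weightOutCLM d m L w‖ ≤ ‖w‖ := by
  refine le_of_sq_le_sq ?_ (norm_nonneg _)
  rw [norm_sq_param, EuclideanSpace.real_norm_sq_eq]
  have : 0 ≤ ∑ h, ∑ i, ∑ j, weightHid w h i j ^ 2 := by positivity
  have : 0 ≤ ∑ i, ∑ j, weightIn w i j ^ 2 := by positivity
  change ∑ i, weightOut w i ^ 2 ≤ _
  linarith

/-- A linear map of norm at most one has controlled jets near a point. -/
theorem JetBound.clm_of_dist {E F : Type*} [NormedAddCommGroup E] [NormedSpace ℝ E]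
    [NormedAddCommGroup F] [NormedSpace ℝ F] (T : E →L[ℝ] F) (hT : ∀ w, ‖T w‖ ≤ ‖w‖) {w w₀ : E}
    {b r : ℝ} (h₀ : ‖T w₀‖ ≤ b) (hw : ‖w - w₀‖ ≤ r) : JetBound T w (b + r) 1 0 := by
  refine JetBound.clm T w ?_ (T.opNorm_le_bound zero_le_one fun v => by simpa using hT v)
  calc ‖T w‖ = ‖T w₀ + T (w - w₀)‖ := by rw [← map_add, add_sub_cancel]
    _ ≤ b + r := (norm_add_le _ _).trans (add_le_add h₀ ((hT _).trans hw))

/-- One layer applied to a vector with a controlled jet. -/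
theorem JetBound.layer {E : Type*} [NormedAddCommGroup E] [NormedSpace ℝ E] {q : ℕ} {σ : ℝ → ℝ}
    {σ₀ σ₁ σ₂ : ℝ} (hσ : IsActivation σ σ₀ σ₁ σ₂) (hm : 0 < m)
    {W : E → EuclideanSpace ℝ (Fin q) →L[ℝ] EuclideanSpace ℝ (Fin m)}
    {f : E → EuclideanSpace ℝ (Fin q)} {w : E} {a S c e : ℝ}
    (hW : JetBound W w (a * √(m : ℝ)) 1 0) (hf : JetBound f w S (c / √(m : ℝ)) (e / √(m : ℝ)))
    (hc : 0 ≤ c) :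
    JetBound (fun w => (1 / √(m : ℝ)) • actMap m σ (W w (f w))) w σ₀
      (σ₁ * (a * c + S) / √(m : ℝ))
      ((σ₂ * (a * c + S) ^ 2 + σ₁ * (a * e + 2 * c)) / √(m : ℝ)) := by
  have hs : 1 ≤ √(m : ℝ) := Real.one_le_sqrt.2 (by exact_mod_cast hm)
  have hs0 : 0 < √(m : ℝ) := by linarith
  have hz := hW.clm_apply hf
  have h₀ : ∀ y : EuclideanSpace ℝ (Fin m), ‖actMap m σ y‖ ≤ σ₀ * √(m : ℝ) := by
    intro y
    have hσ0 := (abs_nonneg _).trans (hσ.bound 0)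
    refine le_of_sq_le_sq ?_ (by positivity)
    rw [EuclideanSpace.real_norm_sq_eq, mul_pow, Real.sq_sqrt (Nat.cast_nonneg _)]
    calc ∑ i, (actMap m σ y i) ^ 2 ≤ ∑ _i : Fin m, σ₀ ^ 2 := Finset.sum_le_sum fun i _ =>
          sq_le_sq' (abs_le.1 (hσ.bound _)).1 (abs_le.1 (hσ.bound _)).2
      _ = _ := by simp [mul_comm]
  -- The `√m` in the bound for `W` cancels the `1/√m` in the derivatives of `f`, so the
  -- pre-activation has derivatives bounded independently of `m`; the outer factor `1/√m` then
  -- restores the scaling.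
  have hz' : JetBound (fun w => W w (f w)) w (a * √(m : ℝ) * S) (a * c + S)
      (a * e + 2 * c) := by
    refine hz.mono le_rfl (le_of_eq ?_) ?_
    · field_simp
    · have h1 : c / √(m : ℝ) ≤ c := div_le_self hc hs
      have h2 : a * √(m : ℝ) * (e / √(m : ℝ)) = a * e := by field_simp
      linarith
  have h := (hz'.comp (contDiff_actMap hσ.smooth) h₀
    (norm_fderiv_actMap_le (hσ.smooth.differentiable (by norm_num)) hσ.bound_deriv)
    (norm_fderiv_fderiv_actMap_le hσ.smooth hσ.bound_deriv2)).const_smul (1 / √(m : ℝ))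
    (by positivity)
  refine h.mono (le_of_eq ?_) (le_of_eq ?_) (le_of_eq ?_)
  · field_simp
  · ring
  · ring

/-- The constants in the bounds `c / √m`, `e / √m` for the first two derivatives of the hidden
states. -/
def jetConst (σ₁ σ₂ a S : ℝ) : ℕ → ℝ × ℝ
  | 0 => (σ₁ * S, σ₂ * S ^ 2)
  | h + 1 =>
    let p := jetConst σ₁ σ₂ a S h
    (σ₁ * (a * p.1 + S), σ₂ * (a * p.1 + S) ^ 2 + σ₁ * (a * p.2 + 2 * p.1))

theorem jetConst_nonneg {σ₁ σ₂ a S : ℝ} (h₁ : 0 ≤ σ₁) (h₂ : 0 ≤ σ₂) (ha : 0 ≤ a) (hS : 0 ≤ S)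
    (h : ℕ) : 0 ≤ (jetConst σ₁ σ₂ a S h).1 ∧ 0 ≤ (jetConst σ₁ σ₂ a S h).2 := by
  induction h with
  | zero => exact ⟨by simp only [jetConst]; positivity, by simp only [jetConst]; positivity⟩
  | succ h ih =>
    obtain ⟨i1, i2⟩ := ih
    exact ⟨by simp only [jetConst]; positivity, by simp only [jetConst]; positivity⟩

/-- Derivative bounds for the hidden states if `a √m` bounds the spectral norms of the weights. -/
theorem jetBound_hiddenState {σ : ℝ → ℝ} {σ₀ σ₁ σ₂ a S : ℝ} (hσ : IsActivation σ σ₀ σ₁ σ₂)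
    (hm : 0 < m) {w : Param d m L} (ha : 0 ≤ a)
    (hin : JetBound (weightInCLM d m L) w (a * √(m : ℝ)) 1 0)
    (hhid : ∀ h, JetBound (weightHidCLM d m L h) w (a * √(m : ℝ)) 1 0)
    {x : EuclideanSpace ℝ (Fin d)} (hxS : ‖x‖ ≤ S) (hσS : σ₀ ≤ S) (h : Fin (L + 1)) :
    JetBound (fun w : Param d m L => WithLp.toLp 2 (hiddenState σ w x h)) w S
      ((jetConst σ₁ σ₂ a S h).1 / √(m : ℝ)) ((jetConst σ₁ σ₂ a S h).2 / √(m : ℝ)) := by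
  have hS := (norm_nonneg _).trans hxS
  have h₁ := (abs_nonneg _).trans (hσ.bound_deriv 0)
  have h₂ := (abs_nonneg _).trans (hσ.bound_deriv2 0)
  induction h using Fin.induction with
  | zero =>
    have h := JetBound.layer hσ hm hin (S := S) (c := 0) (e := 0)
      ((JetBound.const x w hxS).mono le_rfl (by simp) (by simp)) le_rfl
    refine JetBound.mono (f := fun w : Param d m L => _) h hσS (by simp [jetConst])
      (by simp [jetConst])
  | succ h ih =>
    exact (JetBound.layer hσ hm (hhid h) ih (jetConst_nonneg h₁ h₂ ha hS _).1).mono hσS le_rfl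
      le_rfl

/-- `φ = ⟨c, x⟩` is linear in `c`, so each second-order term differentiates the hidden state at
least once and gains `1/√m`. The gradient has no such gain: its `c`-part is the hidden state itself.
-/
theorem jetBound_net {σ : ℝ → ℝ} {σ₀ σ₁ σ₂ κ₀ ζ₀ r₀ : ℝ} (hσ : IsActivation σ σ₀ σ₁ σ₂)
    (hm : 0 < m) {w w₀ : Param d m L} (hκ : kappaInit w₀ ≤ κ₀) (hζ : ‖weightOut w₀‖ ≤ ζ₀)
    (hw : ‖w - w₀‖ ≤ r₀) {x : EuclideanSpace ℝ (Fin d)} (hx : ‖x‖ ≤ 1) :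
    JetBound (net σ x : Param d m L → ℝ) w ((ζ₀ + r₀) * max 1 σ₀)
      ((ζ₀ + r₀) * (jetConst σ₁ σ₂ (κ₀ + r₀) (max 1 σ₀) L).1 + max 1 σ₀)
      (((ζ₀ + r₀) * (jetConst σ₁ σ₂ (κ₀ + r₀) (max 1 σ₀) L).2 +
        2 * (jetConst σ₁ σ₂ (κ₀ + r₀) (max 1 σ₀) L).1) / √(m : ℝ)) := by
  have hs : 1 ≤ √(m : ℝ) := Real.one_le_sqrt.2 (by exact_mod_cast hm)
  have hs0 : 0 < √(m : ℝ) := by linarith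
  have hr := (norm_nonneg _).trans hw
  have hζ0 := (norm_nonneg _).trans hζ
  have h₁ := (abs_nonneg _).trans (hσ.bound_deriv 0)
  have h₂ := (abs_nonneg _).trans (hσ.bound_deriv2 0)
  have hmax : max (specNorm (weightIn w₀)) (⨆ h : Fin L, specNorm (weightHid w₀ h))
      ≤ κ₀ * √(m : ℝ) := (div_le_iff₀ hs0).1 hκ
  have hκin := (le_max_left _ _).trans hmax
  have hκhid : ∀ h, specNorm (weightHid w₀ h) ≤ κ₀ * √(m : ℝ) := fun h =>
    (le_ciSup (f := fun h => specNorm (weightHid w₀ h)) (Set.finite_range _).bddAbove h).trans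
      ((le_max_right _ _).trans hmax)
  have hκ0 : 0 ≤ κ₀ := by
    have : 0 ≤ κ₀ * √(m : ℝ) := (norm_nonneg (matCLM (weightIn w₀))).trans hκin
    exact nonneg_of_mul_nonneg_left this hs0
  -- Moving by `r₀` from `w₀` changes spectral norms by at most `r₀`, and `m ≥ 1` absorbs this into
  -- the scale `√m`.
  have hle : κ₀ * √(m : ℝ) + r₀ ≤ (κ₀ + r₀) * √(m : ℝ) := by nlinarith
  have hin : JetBound (weightInCLM d m L) w ((κ₀ + r₀) * √(m : ℝ)) 1 0 :=
    (JetBound.clm_of_dist _ norm_weightInCLM_apply_le (b := κ₀ * √(m : ℝ)) hκin hw).mono hle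
      le_rfl le_rfl
  have hhid : ∀ h, JetBound (weightHidCLM d m L h) w ((κ₀ + r₀) * √(m : ℝ)) 1 0 := fun h =>
    (JetBound.clm_of_dist _ (norm_weightHidCLM_apply_le h) (b := κ₀ * √(m : ℝ)) (hκhid h) hw).mono
      hle le_rfl le_rfl
  have hout : JetBound ((innerSL ℝ).comp (weightOutCLM d m L)) w (ζ₀ + r₀) 1 0 := by
    refine JetBound.clm_of_dist _ (fun v => ?_) (b := ζ₀) (w₀ := w₀) ?_ hw
    · rw [ContinuousLinearMap.comp_apply, innerSL_apply_norm]
      exact norm_weightOutCLM_apply_le v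
    · rw [ContinuousLinearMap.comp_apply, innerSL_apply_norm]
      exact hζ
  have hS : (0 : ℝ) ≤ max 1 σ₀ := zero_le_one.trans (le_max_left _ _)
  have hc := jetConst_nonneg h₁ h₂ (add_nonneg hκ0 hr) hS L
  have h := hout.clm_apply (jetBound_hiddenState hσ hm (add_nonneg hκ0 hr) hin hhid
    (hx.trans (le_max_left 1 σ₀)) (le_max_right 1 σ₀) (Fin.last L))
  have hnet : (net σ x : Param d m L → ℝ) = fun w =>
      ((innerSL ℝ).comp (weightOutCLM d m L)) w
        (WithLp.toLp 2 (hiddenState σ w x (Fin.last L))) := by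
    ext v
    simp only [ContinuousLinearMap.comp_apply, innerSL_apply_apply, PiLp.inner_apply, net]
    exact Finset.sum_congr rfl fun i _ => mul_comm _ _
  rw [hnet]
  refine h.mono le_rfl ?_ (le_of_eq ?_)
  · rw [one_mul, Fin.val_last]
    gcongr
    exact div_le_self hc.1 hs
  · rw [Fin.val_last]
    ring

theorem gradNet_eq (σ : ℝ → ℝ) (x : EuclideanSpace ℝ (Fin d)) :
    (gradNet σ x : Param d m L → Param d m L) = fun w =>
      (InnerProductSpace.toDual ℝ (Param d m L)).symm (fderiv ℝ (net σ x) w) := rfl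

theorem norm_gradNet (σ : ℝ → ℝ) (x : EuclideanSpace ℝ (Fin d)) (w : Param d m L) :
    ‖gradNet σ x w‖ = ‖fderiv ℝ (net σ x) w‖ := by
  rw [gradNet_eq, LinearIsometryEquiv.norm_map]

theorem norm_hessNet (σ : ℝ → ℝ) (x : EuclideanSpace ℝ (Fin d)) (w : Param d m L) :
    ‖hessNet σ x w‖ = ‖fderiv ℝ (fderiv ℝ (net σ x)) w‖ := by
  rw [hessNet, gradNet_eq, ← norm_iteratedFDeriv_one, ← norm_iteratedFDeriv_one]
  exact (InnerProductSpace.toDual ℝ (Param d m L)).symm.norm_iteratedFDeriv_comp_left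
    (fderiv ℝ (net σ x)) w 1

end SGN

namespace SGN

/-! ### Quadratic forms and determinants -/

section Matrix

open Matrix

variable {ι κ : Type*} [Fintype ι] [Fintype κ]

open MatrixOrder in
-- Factor `Y = RᵀR` and use Cauchy–Schwarz in each row of `R`.
theorem dotProduct_mulVec_le_trace_mul {Y : Matrix κ κ ℝ} (hY : Y.PosSemidef)
    (g : κ → ℝ) : g ⬝ᵥ Y *ᵥ g ≤ Y.trace * (g ⬝ᵥ g) := by
  classical
  obtain ⟨R, rfl⟩ := CStarAlgebra.nonneg_iff_eq_star_mul_self.1 hY.nonneg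
  have h1 : g ⬝ᵥ (star R * R) *ᵥ g = ∑ i, (∑ j, R i j * g j) ^ 2 := by
    rw [← mulVec_mulVec, dotProduct_mulVec, star_eq_conjTranspose,
      conjTranspose_eq_transpose_of_trivial, vecMul_transpose]
    simp [dotProduct, mulVec, sq]
  have h2 : (star R * R).trace = ∑ i, ∑ j, R i j ^ 2 := by
    rw [Finset.sum_comm]
    simp [trace, mul_apply, star_eq_conjTranspose, sq]
  have h3 : g ⬝ᵥ g = ∑ j, g j ^ 2 := by simp [dotProduct, sq]
  rw [h1, h2, h3, Finset.sum_mul]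
  exact Finset.sum_le_sum fun i _ => Finset.sum_mul_sq_le_sq_mul_sq _ _ _

/-- Apply `log x ≤ x - 1` to each eigenvalue. -/
theorem log_det_le_trace_sub_card [DecidableEq κ] {X : Matrix κ κ ℝ} (hX : X.PosDef) :
    Real.log X.det ≤ X.trace - Fintype.card κ := by
  rw [hX.isHermitian.det_eq_prod_eigenvalues, hX.isHermitian.trace_eq_sum_eigenvalues]
  simp only [RCLike.ofReal_real_eq_id, id]
  rw [Real.log_prod fun i _ => (hX.eigenvalues_pos i).ne']
  calc _ ≤ ∑ i, (hX.isHermitian.eigenvalues i - 1) :=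
        Finset.sum_le_sum fun i _ => Real.log_le_sub_one_of_pos (hX.eigenvalues_pos i)
    _ = _ := by simp

variable {A : Matrix ι ι ℝ} {J : Matrix κ ι ℝ} {α : ℝ}

theorem posDef_add_gram (hA : A.PosDef) (hα : 0 ≤ α) (J : Matrix κ ι ℝ) :
    (A + α • (Jᵀ * J)).PosDef := by
  refine hA.add_posSemidef (PosSemidef.smul ?_ hα)
  rw [← conjTranspose_eq_transpose_of_trivial]
  exact posSemidef_conjTranspose_mul_self J

theorem dotProduct_add_gram_mulVec (A : Matrix ι ι ℝ) (J : Matrix κ ι ℝ) (α : ℝ) (v : ι → ℝ) :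
    v ⬝ᵥ (A + α • (Jᵀ * J)) *ᵥ v = v ⬝ᵥ A *ᵥ v + α * (J *ᵥ v ⬝ᵥ J *ᵥ v) := by
  rw [add_mulVec, dotProduct_add, smul_mulVec, dotProduct_smul, ← mulVec_mulVec,
    dotProduct_mulVec v Jᵀ, vecMul_transpose, smul_eq_mul]

/-- The squared norm of `Jᵀ g` in the metric `(A + α JᵀJ)⁻¹` if `c JᵀJ ≤ A`. -/
theorem gram_inv_quadForm_le [DecidableEq ι] (hA : A.PosDef) (hα : 0 ≤ α) {c : ℝ}
    (hc : ∀ v, c * (J *ᵥ v ⬝ᵥ J *ᵥ v) ≤ v ⬝ᵥ A *ᵥ v) (hcα : 0 ≤ α + c) (g : κ → ℝ) :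
    (α + c) * (Jᵀ *ᵥ g ⬝ᵥ (A + α • (Jᵀ * J))⁻¹ *ᵥ (Jᵀ *ᵥ g)) ≤ g ⬝ᵥ g := by
  have hH := posDef_add_gram hA hα J
  set H := A + α • (Jᵀ * J) with hHdef
  -- The quantity `q` to bound equals both `⟨g, Jv⟩` and `vᵀHv`, and the latter is at least `(α +
  -- c)|Jv|²`. Cauchy–Schwarz gives `(α + c)q² ≤ |g|² q`, and one divides by `q` if it is positive.
  set v := H⁻¹ *ᵥ (Jᵀ *ᵥ g) with hv
  have hHv : H *ᵥ v = Jᵀ *ᵥ g := by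
    rw [hv, mulVec_mulVec, mul_nonsing_inv _ (isUnit_iff_ne_zero.2 hH.det_pos.ne'), one_mulVec]
  have hq1 : Jᵀ *ᵥ g ⬝ᵥ v = g ⬝ᵥ J *ᵥ v := by
    rw [mulVec_transpose, dotProduct_mulVec g J v]
  have hq2 : Jᵀ *ᵥ g ⬝ᵥ v = v ⬝ᵥ A *ᵥ v + α * (J *ᵥ v ⬝ᵥ J *ᵥ v) := by
    rw [← dotProduct_add_gram_mulVec, ← hHdef, hHv, dotProduct_comm]
  have hcs : (g ⬝ᵥ J *ᵥ v) ^ 2 ≤ (g ⬝ᵥ g) * (J *ᵥ v ⬝ᵥ J *ᵥ v) := by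
    have := Finset.sum_mul_sq_le_sq_mul_sq Finset.univ g (J *ᵥ v)
    simpa only [dotProduct, sq] using this
  have hgg : 0 ≤ g ⬝ᵥ g := Finset.sum_nonneg fun i _ => mul_self_nonneg _
  have hlow := hc v
  set q := Jᵀ *ᵥ g ⬝ᵥ v
  rw [← hq1] at hcs
  rcases le_or_gt q 0 with hq | hq
  · exact (mul_nonpos_of_nonneg_of_nonpos hcα hq).trans hgg
  · have h1 : (α + c) * (J *ᵥ v ⬝ᵥ J *ᵥ v) ≤ q := by linarith
    have h2 := mul_le_mul_of_nonneg_left h1 hgg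
    have h3 := mul_le_mul_of_nonneg_left hcs hcα
    refine le_of_mul_le_mul_right ?_ hq
    nlinarith

theorem mul_transpose_mulVec_dotProduct (M : Matrix ι ι ℝ) (J : Matrix κ ι ℝ) (g : κ → ℝ) :
    g ⬝ᵥ (J * M * Jᵀ) *ᵥ g = Jᵀ *ᵥ g ⬝ᵥ M *ᵥ (Jᵀ *ᵥ g) := by
  rw [← mulVec_mulVec, ← mulVec_mulVec, dotProduct_mulVec g J, ← mulVec_transpose]

theorem gram_inv_posSemidef [DecidableEq ι] (hA : A.PosDef) (hα : 0 ≤ α) (J : Matrix κ ι ℝ) :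
    (J * (A + α • (Jᵀ * J))⁻¹ * Jᵀ).PosSemidef := by
  have := (posDef_add_gram hA hα J).inv.posSemidef.mul_mul_conjTranspose_same J
  rwa [conjTranspose_eq_transpose_of_trivial] at this

/-- The elliptical potential estimate. With `X = 1 - α J H⁻¹ Jᵀ`, Sylvester's identity gives `det X
= det A / det H`, and `log det X ≤ tr X - card κ = -α tr(J H⁻¹ Jᵀ)`. -/
theorem mul_trace_gram_inv_le_log_det [DecidableEq ι] (hA : A.PosDef) (hα : 0 ≤ α)
    (J : Matrix κ ι ℝ) :
    α * (J * (A + α • (Jᵀ * J))⁻¹ * Jᵀ).trace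
      ≤ Real.log ((A + α • (Jᵀ * J)).det / A.det) := by
  classical
  have hH := posDef_add_gram hA hα J
  have hY := gram_inv_posSemidef hA hα J
  have hq := fun g => gram_inv_quadForm_le (J := J) hA hα (c := 0)
    (fun v => by simpa using hA.posSemidef.dotProduct_mulVec_nonneg v) (by simpa using hα) g
  set H := A + α • (Jᵀ * J) with hHdef
  set X : Matrix κ κ ℝ := 1 - α • (J * H⁻¹ * Jᵀ) with hX
  have hdet : X.det = A.det / H.det := by
    have h1 : X.det = (1 - (α • H⁻¹ * Jᵀ) * J).det := by
      rw [← det_one_sub_mul_comm, hX, Matrix.smul_mul, Matrix.mul_smul, Matrix.mul_assoc]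
    have h2 : 1 - (α • H⁻¹ * Jᵀ) * J = H⁻¹ * A := by
      rw [eq_sub_of_add_eq hHdef.symm, Matrix.mul_sub,
        nonsing_inv_mul _ (isUnit_iff_ne_zero.2 hH.det_pos.ne'), Matrix.smul_mul, Matrix.smul_mul,
        Matrix.mul_smul, Matrix.mul_assoc]
    rw [h1, h2, det_mul, det_nonsing_inv, Ring.inverse_eq_inv', div_eq_inv_mul]
  have hdetpos : 0 < X.det := hdet ▸ div_pos hA.det_pos hH.det_pos
  -- This is the case `c = 0` of `gram_inv_quadForm_le`; the nonzero determinant upgrades it to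
  -- positive definiteness.
  have hXpsd : X.PosSemidef := by
    refine .of_dotProduct_mulVec_nonneg ?_ fun g => ?_
    · refine isHermitian_one.sub ?_
      simp only [IsHermitian, conjTranspose_smul, hY.isHermitian.eq, star_trivial]
    · have := hq g
      rw [hX, sub_mulVec, one_mulVec, smul_mulVec, star_trivial, dotProduct_sub, dotProduct_smul,
        mul_transpose_mulVec_dotProduct, smul_eq_mul]
      linarith
  have hXpd : X.PosDef := hXpsd.posDef_iff_det_ne_zero.2 hdetpos.ne'
  have h := log_det_le_trace_sub_card hXpd
  rw [hdet, hX, trace_sub, trace_one, trace_smul, smul_eq_mul] at h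
  rw [← inv_div, Real.log_inv]
  linarith

theorem log_det_add_gram_div_det_nonneg [DecidableEq ι] (hA : A.PosDef) (hα : 0 ≤ α)
    (J : Matrix κ ι ℝ) :
    0 ≤ Real.log ((A + α • (Jᵀ * J)).det / A.det) :=
  (mul_nonneg hα (gram_inv_posSemidef hA hα J).trace_nonneg).trans
    (mul_trace_gram_inv_le_log_det hA hα J)

theorem mul_gram_inv_quadForm_le_log_det [DecidableEq ι] (hA : A.PosDef) (hα : 0 ≤ α)
    (J : Matrix κ ι ℝ) (g : κ → ℝ) :
    α * (Jᵀ *ᵥ g ⬝ᵥ (A + α • (Jᵀ * J))⁻¹ *ᵥ (Jᵀ *ᵥ g))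
      ≤ Real.log ((A + α • (Jᵀ * J)).det / A.det) * (g ⬝ᵥ g) := by
  have h1 := dotProduct_mulVec_le_trace_mul (gram_inv_posSemidef hA hα J) g
  rw [mul_transpose_mulVec_dotProduct] at h1
  have hgg : 0 ≤ g ⬝ᵥ g := Finset.sum_nonneg fun i _ => mul_self_nonneg _
  calc _ ≤ α * ((J * (A + α • (Jᵀ * J))⁻¹ * Jᵀ).trace * (g ⬝ᵥ g)) :=
        mul_le_mul_of_nonneg_left h1 hα
    _ = α * (J * (A + α • (Jᵀ * J))⁻¹ * Jᵀ).trace * (g ⬝ᵥ g) := by ring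
    _ ≤ _ := mul_le_mul_of_nonneg_right (mul_trace_gram_inv_le_log_det hA hα J) hgg

/-! ### The metric projection -/

theorem sqNorm_add_smul {M : Matrix ι ι ℝ} (hM : M.IsHermitian) (a b : EuclideanSpace ℝ ι)
    (t : ℝ) : sqNorm M (a + t • b)
      = sqNorm M a + 2 * t * (a.ofLp ⬝ᵥ M *ᵥ b.ofLp) + t ^ 2 * sqNorm M b := by
  have hsymm : b.ofLp ⬝ᵥ M *ᵥ a.ofLp = a.ofLp ⬝ᵥ M *ᵥ b.ofLp := by
    rw [dotProduct_mulVec, dotProduct_comm, ← mulVec_transpose,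
      ← conjTranspose_eq_transpose_of_trivial, hM.eq]
  simp only [sqNorm, WithLp.ofLp_add, WithLp.ofLp_smul, mulVec_add, mulVec_smul, add_dotProduct,
    dotProduct_add, smul_dotProduct, dotProduct_smul, smul_eq_mul, hsymm]
  ring

/-- The projection step of a preconditioned gradient method does not increase the distance to a
point of the convex set. -/
theorem IsMetricProj.sqNorm_sub_le [DecidableEq ι] {C : Set (EuclideanSpace ℝ ι)} (hC : Convex ℝ C)
    {H : Matrix ι ι ℝ} (hH : H.PosDef) {w p v : EuclideanSpace ℝ ι} {η : ℝ} {ψ : ι → ℝ}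
    (hp : IsMetricProj C H (w - η • WithLp.toLp 2 (H⁻¹ *ᵥ ψ)) p) (hv : v ∈ C) :
    sqNorm H (v - p)
      ≤ sqNorm H (v - w) + 2 * η * ((v - w).ofLp ⬝ᵥ ψ) + η ^ 2 * (ψ ⬝ᵥ H⁻¹ *ᵥ ψ) := by
  have hcancel : H *ᵥ (H⁻¹ *ᵥ ψ) = ψ := by
    rw [mulVec_mulVec, mul_nonsing_inv _ (isUnit_iff_ne_zero.2 hH.det_pos.ne'), one_mulVec]
  have hstep : sqNorm H (v - (w - η • WithLp.toLp 2 (H⁻¹ *ᵥ ψ)))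
      = sqNorm H (v - w) + 2 * η * ((v - w).ofLp ⬝ᵥ ψ) + η ^ 2 * (ψ ⬝ᵥ H⁻¹ *ᵥ ψ) := by
    rw [sub_sub_eq_add_sub, add_sub_right_comm, sqNorm_add_smul hH.isHermitian, hcancel]
    congr 2
    rw [sqNorm, hcancel, dotProduct_comm]
  rw [← hstep]
  set u := w - η • WithLp.toLp 2 (H⁻¹ *ᵥ ψ)
  -- The variational inequality for the projection: compare `p` with `p + t(v - p)`, divide by `t`,
  -- and then let `t → 0`.
  have key : ∀ t : ℝ, 0 < t → t ≤ 1 →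
      0 ≤ 2 * ((p - u).ofLp ⬝ᵥ H *ᵥ (v - p).ofLp) + t * sqNorm H (v - p) := by
    intro t ht ht1
    have hmem : p + t • (v - p) ∈ C := hC.add_smul_sub_mem hp.1 hv ⟨ht.le, ht1⟩
    have h := hp.2 _ hmem
    rw [add_sub_right_comm, sqNorm_add_smul hH.isHermitian] at h
    refine nonneg_of_mul_nonneg_right (a := t) ?_ ht
    nlinarith
  have hab : 0 ≤ (p - u).ofLp ⬝ᵥ H *ᵥ (v - p).ofLp := by
    have hlim : Filter.Tendsto (fun t : ℝ => 2 * ((p - u).ofLp ⬝ᵥ H *ᵥ (v - p).ofLp)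
        + t * sqNorm H (v - p)) (nhdsWithin 0 (Set.Ioi 0))
        (nhds (2 * ((p - u).ofLp ⬝ᵥ H *ᵥ (v - p).ofLp) + 0 * sqNorm H (v - p))) :=
      (Continuous.tendsto (by fun_prop) _).mono_left nhdsWithin_le_nhds
    have h0 := ge_of_tendsto hlim (by
      filter_upwards [Ioc_mem_nhdsGT (zero_lt_one' ℝ)] with t ht using key t ht.1 ht.2)
    linarith
  have hdec := sqNorm_add_smul hH.isHermitian (p - u) (v - p) 1
  have hpos : 0 ≤ sqNorm H (p - u) := hH.posSemidef.dotProduct_mulVec_nonneg _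
  rw [one_smul, add_comm, sub_add_sub_cancel] at hdec
  rw [hdec]
  linarith

end Matrix

end SGN

namespace SGN

/-! ### The regret bound along a fixed sequence of batches -/

open Matrix

namespace Setup

variable {d m L n : ℕ} {s : Setup d m L n} {ν Lℓ G E : ℝ}

/-- The regularity of the predictor and of the loss that the regret bound uses: `G` bounds the
gradients of the predictor, `E` its linearization error on `C`, and `Lℓ` the slope of the loss. -/
structure Regular (s : Setup d m L n) (ν Lℓ G E : ℝ) : Prop where
  isCompact : IsCompact s.C
  convex : Convex ℝ s.C
  init_mem : s.w₀ ∈ s.C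
  norm_grad_le : ∀ j, ∀ w ∈ s.C, ‖gradNet s.σ (s.z j).1 w‖ ≤ G
  linearization_le : ∀ j, ∀ w ∈ s.C, ∀ v ∈ s.C,
    |net s.σ (s.z j).1 v - net s.σ (s.z j).1 w - inner ℝ (gradNet s.σ (s.z j).1 w) (v - w)| ≤ E
  loss_ge : ∀ j u v, s.loss u (s.z j) + deriv (fun u => s.loss u (s.z j)) u * (v - u)
    + ν / 2 * (v - u) ^ 2 ≤ s.loss v (s.z j)
  abs_deriv_loss_le : ∀ j, ∀ w ∈ s.C,
    |deriv (fun u => s.loss u (s.z j)) (net s.σ (s.z j).1 w)| ≤ Lℓ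

/-- The loss of the predictor with parameter `w` on the `j`-th sample. -/
def sampleLoss (s : Setup d m L n) (w : Param d m L) (j : Fin n) : ℝ :=
  s.loss (net s.σ (s.z j).1 w) (s.z j)

theorem jac_mulVec_apply (I : Finset (Fin n)) (w v : Param d m L) (j : {j // j ∈ I}) :
    (s.jac I w *ᵥ v.ofLp) j = inner ℝ (gradNet s.σ (s.z j).1 w) v := by
  rw [PiLp.inner_apply]
  exact Finset.sum_congr rfl fun i _ => mul_comm _ _

theorem jac_mulVec_dotProduct_self (I : Finset (Fin n)) (w v : Param d m L) :
    s.jac I w *ᵥ v.ofLp ⬝ᵥ s.jac I w *ᵥ v.ofLp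
      = ∑ j ∈ I, inner ℝ (gradNet s.σ (s.z j).1 w) v ^ 2 := by
  rw [← Finset.sum_coe_sort I]
  exact Finset.sum_congr rfl fun j _ => by rw [jac_mulVec_apply, sq]

theorem dotProduct_batchGrad (I : Finset (Fin n)) (w v : Param d m L) :
    v.ofLp ⬝ᵥ s.batchGrad I w = ∑ j ∈ I, deriv (fun u => s.loss u (s.z j))
      (net s.σ (s.z j).1 w) * inner ℝ (gradNet s.σ (s.z j).1 w) v := by
  rw [batchGrad, dotProduct_mulVec, vecMul_transpose, dotProduct_comm, ← Finset.sum_coe_sort I]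
  exact Finset.sum_congr rfl fun j _ => by rw [jac_mulVec_apply]; rfl

/-- The curvature of the loss controls the squared linearized increment, with errors only from
linearization. This is where the lower bound on `ξ` enters. -/
theorem Regular.sample_le (hs : s.Regular ν Lℓ G E) (hα : 0 < s.α) (hην : 2 * s.α ≤ s.η * ν)
    (hη : 0 < s.η) {w v : Param d m L} (hw : w ∈ s.C) (hv : v ∈ s.C) (j : Fin n) :
    s.α * inner ℝ (gradNet s.σ (s.z j).1 w) (v - w) ^ 2
      + 2 * s.η * (deriv (fun u => s.loss u (s.z j)) (net s.σ (s.z j).1 w)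
        * inner ℝ (gradNet s.σ (s.z j).1 w) (v - w))
      ≤ 2 * s.η * (s.sampleLoss v j - s.sampleLoss w j) + (2 * s.η * Lℓ * E + 2 * s.α * E ^ 2) := by
  have h1 := hs.loss_ge j (net s.σ (s.z j).1 w) (net s.σ (s.z j).1 v)
  have h2 := hs.linearization_le j w hw v hv
  have h3 := hs.abs_deriv_loss_le j w hw
  simp only [sampleLoss]
  set g := deriv (fun u => s.loss u (s.z j)) (net s.σ (s.z j).1 w)
  set a := inner ℝ (gradNet s.σ (s.z j).1 w) (v - w)
  set δ := net s.σ (s.z j).1 v - net s.σ (s.z j).1 w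
  have hE := (abs_nonneg _).trans h2
  have h4 : g * (a - δ) ≤ Lℓ * E := by
    refine (le_abs_self _).trans ?_
    rw [abs_mul, abs_sub_comm]
    exact mul_le_mul h3 h2 (abs_nonneg _) ((abs_nonneg _).trans h3)
  have h5 : (δ - a) ^ 2 ≤ E ^ 2 := sq_le_sq' (abs_le.1 h2).1 (abs_le.1 h2).2
  -- The right side minus the left is `α(2δ - a)²`.
  have h6 : s.α * a ^ 2 ≤ 2 * s.α * δ ^ 2 + 2 * s.α * (δ - a) ^ 2 := by
    have : 0 ≤ s.α * (2 * δ - a) ^ 2 := by positivity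
    linarith
  have h7 : 2 * s.α * δ ^ 2 ≤ s.η * ν * δ ^ 2 := mul_le_mul_of_nonneg_right hην (sq_nonneg _)
  have h8 := mul_le_mul_of_nonneg_left h5 hα.le
  have h9 := mul_le_mul_of_nonneg_left h4 hη.le
  have h10 := mul_le_mul_of_nonneg_left h1 hη.le
  linarith

/-- One step of the method, started from the metric `A` and the point `w`. -/
theorem Regular.step_le (hs : s.Regular ν Lℓ G E) (hα : 0 < s.α) (hην : 2 * s.α ≤ s.η * ν)
    (hη : 0 < s.η) {A : Matrix (ParamIdx d m L) (ParamIdx d m L) ℝ} (hA : A.PosDef)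
    {w v p : Param d m L} (hw : w ∈ s.C) (hv : v ∈ s.C) (I : Finset (Fin n))
    {H : Matrix (ParamIdx d m L) (ParamIdx d m L) ℝ}
    (hH : H = A + s.α • ((s.jac I w)ᵀ * s.jac I w))
    (hp : IsMetricProj s.C H (w - s.η • WithLp.toLp 2 (H⁻¹ *ᵥ s.batchGrad I w)) p) :
    sqNorm H (v - p) + 2 * s.η * ∑ j ∈ I, (s.sampleLoss w j - s.sampleLoss v j)
      ≤ sqNorm A (v - w) + I.card * (2 * s.η * Lℓ * E + 2 * s.α * E ^ 2)
        + s.η ^ 2 * (s.batchGrad I w ⬝ᵥ H⁻¹ *ᵥ s.batchGrad I w) := by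
  have hHpd : H.PosDef := hH ▸ posDef_add_gram hA hα.le _
  have h1 := hp.sqNorm_sub_le hs.convex hHpd hv
  -- The cost of the larger metric is precisely the quadratic term that `sample_le` absorbs.
  have h2 : sqNorm H (v - w) = sqNorm A (v - w)
      + s.α * ∑ j ∈ I, inner ℝ (gradNet s.σ (s.z j).1 w) (v - w) ^ 2 := by
    rw [← jac_mulVec_dotProduct_self, sqNorm, sqNorm, hH, dotProduct_add_gram_mulVec]
  rw [dotProduct_batchGrad, h2] at h1
  have h3 := Finset.sum_le_sum fun j (_ : j ∈ I) => hs.sample_le hα hην hη hw hv j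
  rw [Finset.sum_add_distrib, Finset.sum_add_distrib, ← Finset.mul_sum, ← Finset.mul_sum,
    ← Finset.mul_sum, Finset.sum_const, nsmul_eq_mul, Finset.sum_sub_distrib] at h3
  rw [Finset.sum_sub_distrib]
  linarith

theorem state_fst_succ (I : ℕ → Finset (Fin n)) (k : ℕ) :
    s.iter I (k + 1) = metricProj s.C (s.state I (k + 1)).2
      (s.iter I k - s.η • WithLp.toLp 2
        ((s.state I (k + 1)).2⁻¹ *ᵥ s.batchGrad (I k) (s.iter I k))) := rfl

theorem state_snd_succ (I : ℕ → Finset (Fin n)) (k : ℕ) :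
    (s.state I (k + 1)).2
      = (s.state I k).2 + s.α • ((s.jac (I k) (s.iter I k))ᵀ * s.jac (I k) (s.iter I k)) := rfl

theorem iter_mem (hC : IsCompact s.C) (hw₀ : s.w₀ ∈ s.C) (I : ℕ → Finset (Fin n)) (k : ℕ) :
    s.iter I k ∈ s.C := by
  cases k with
  | zero => exact hw₀
  | succ k =>
    rw [state_fst_succ]
    exact (isMetricProj_metricProj hC ⟨_, hw₀⟩ _ _).1

theorem Regular.iter_mem (hs : s.Regular ν Lℓ G E) (I : ℕ → Finset (Fin n)) (k : ℕ) :
    s.iter I k ∈ s.C :=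
  Setup.iter_mem hs.isCompact hs.init_mem I k

theorem posDef_state (hα : 0 < s.α) (hlam : 0 < s.lam) (I : ℕ → Finset (Fin n)) (k : ℕ) :
    (s.state I k).2.PosDef := by
  induction k with
  | zero => exact PosDef.one.smul hlam
  | succ k ih =>
    rw [state_snd_succ]
    exact posDef_add_gram ih hα.le _

theorem logDet_zero (hα : 0 < s.α) (hlam : 0 < s.lam) (I : ℕ → Finset (Fin n)) :
    s.logDet I 0 = 0 := by
  rw [logDet, div_self (show (s.precond I 0).det ≠ 0 from (posDef_state hα hlam I 1).det_pos.ne'),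
    Real.log_one]

/-- The indices are shifted: the matrix in `state I (k + 1)` is `H_k`, so the added ratio is `det
H_{k+1} / det H_k`. -/
theorem logDet_succ (hα : 0 < s.α) (hlam : 0 < s.lam) (I : ℕ → Finset (Fin n)) (k : ℕ) :
    s.logDet I (k + 1)
      = s.logDet I k + Real.log ((s.state I (k + 2)).2.det / (s.state I (k + 1)).2.det) := by
  have h0 := (posDef_state hα hlam I 1).det_pos.ne'
  have h1 := (posDef_state hα hlam I (k + 1)).det_pos.ne'
  have h2 := (posDef_state hα hlam I (k + 2)).det_pos.ne'
  simp only [logDet, precond]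
  rw [Real.log_div h2 h0, Real.log_div h1 h0, Real.log_div h2 h1]
  ring

theorem logDet_le_succ (hα : 0 < s.α) (hlam : 0 < s.lam) (I : ℕ → Finset (Fin n)) (k : ℕ) :
    s.logDet I k ≤ s.logDet I (k + 1) := by
  rw [logDet_succ hα hlam, state_snd_succ I (k + 1)]
  exact le_add_of_nonneg_right
    (log_det_add_gram_div_det_nonneg (posDef_state hα hlam I (k + 1)) hα.le _)

theorem logDet_nonneg (hα : 0 < s.α) (hlam : 0 < s.lam) (I : ℕ → Finset (Fin n)) (k : ℕ) :
    0 ≤ s.logDet I k := by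
  induction k with
  | zero => rw [logDet_zero hα hlam]
  | succ k ih => exact ih.trans (logDet_le_succ hα hlam I k)

/-- The squared norm of the `k`-th mini-batch gradient in the metric `H_k⁻¹`. -/
def gradQuad (s : Setup d m L n) (I : ℕ → Finset (Fin n)) (k : ℕ) : ℝ :=
  s.batchGrad (I k) (s.iter I k) ⬝ᵥ
    (s.state I (k + 1)).2⁻¹ *ᵥ s.batchGrad (I k) (s.iter I k)

theorem Regular.lossGrad_dotProduct_le (hs : s.Regular ν Lℓ G E) (I : Finset (Fin n))
    {w : Param d m L} (hw : w ∈ s.C) : s.lossGrad I w ⬝ᵥ s.lossGrad I w ≤ I.card * Lℓ ^ 2 := by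
  calc s.lossGrad I w ⬝ᵥ s.lossGrad I w ≤ ∑ _j : {j // j ∈ I}, Lℓ ^ 2 :=
        Finset.sum_le_sum fun j _ => by
          have h := abs_le.1 (hs.abs_deriv_loss_le j w hw)
          rw [← sq]
          exact sq_le_sq' h.1 h.2
    _ = _ := by simp

/-- `logDet` starts at `H_0` and does not see this step. Instead `αγ JᵀJ ≤ λI`, so
`gram_inv_quadForm_le` applies with `c = αγ` and gives the factor `1/(α(1 + γ))`. -/
theorem Regular.gradQuad_zero_le (hs : s.Regular ν Lℓ G E) (hα : 0 < s.α) (hlam : 0 < s.lam)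
    (I : ℕ → Finset (Fin n)) {γ : ℝ} (hγ : 0 ≤ γ) (hγG : s.α * γ * ((I 0).card * G ^ 2) ≤ s.lam) :
    s.gradQuad I 0 ≤ (I 0).card * Lℓ ^ 2 / s.α * (1 / (γ + 1)) := by
  have hA := posDef_state hα hlam I 0
  have hJ : ∀ v : ParamIdx d m L → ℝ,
      s.α * γ * (s.jac (I 0) (s.iter I 0) *ᵥ v ⬝ᵥ s.jac (I 0) (s.iter I 0) *ᵥ v)
        ≤ v ⬝ᵥ (s.state I 0).2 *ᵥ v := by
    intro v
    have h1 := jac_mulVec_dotProduct_self (s := s) (I 0) (s.iter I 0) (WithLp.toLp 2 v)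
    simp only at h1
    have h2 : v ⬝ᵥ (s.state I 0).2 *ᵥ v = s.lam * ‖WithLp.toLp 2 v‖ ^ 2 := by
      rw [state, smul_mulVec, one_mulVec, dotProduct_smul, smul_eq_mul,
        EuclideanSpace.real_norm_sq_eq]
      simp [dotProduct, sq]
    rw [h1, h2]
    have h3 : ∑ j ∈ I 0, inner ℝ (gradNet s.σ (s.z j).1 (s.iter I 0)) (WithLp.toLp 2 v) ^ 2
        ≤ (I 0).card * G ^ 2 * ‖WithLp.toLp 2 v‖ ^ 2 := by
      rw [mul_assoc, ← nsmul_eq_mul]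
      refine Finset.sum_le_card_nsmul _ _ _ fun j _ => ?_
      have h4 := (abs_real_inner_le_norm (gradNet s.σ (s.z j).1 (s.iter I 0))
        (WithLp.toLp 2 v)).trans (mul_le_mul_of_nonneg_right
          (hs.norm_grad_le j _ (hs.iter_mem I 0)) (norm_nonneg _))
      rw [← mul_pow]
      exact sq_le_sq' (abs_le.1 h4).1 (abs_le.1 h4).2
    calc _ ≤ s.α * γ * ((I 0).card * G ^ 2 * ‖WithLp.toLp 2 v‖ ^ 2) :=
          mul_le_mul_of_nonneg_left h3 (by positivity)
      _ = s.α * γ * ((I 0).card * G ^ 2) * ‖WithLp.toLp 2 v‖ ^ 2 := by ring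
      _ ≤ _ := mul_le_mul_of_nonneg_right hγG (by positivity)
  have h := (gram_inv_quadForm_le hA hα.le hJ (by positivity)
    (s.lossGrad (I 0) (s.iter I 0))).trans
    (hs.lossGrad_dotProduct_le (I 0) (hs.iter_mem I 0))
  rw [← state_snd_succ] at h
  change (s.α + s.α * γ) * s.gradQuad I 0 ≤ _ at h
  rw [div_mul_div_comm, mul_one, le_div_iff₀ (by positivity)]
  linarith

theorem Regular.gradQuad_le_log_det (hs : s.Regular ν Lℓ G E) (hα : 0 < s.α) (hlam : 0 < s.lam)
    (I : ℕ → Finset (Fin n)) (k : ℕ) :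
    s.gradQuad I k ≤ (I k).card * Lℓ ^ 2 / s.α
      * Real.log ((s.state I (k + 1)).2.det / (s.state I k).2.det) := by
  have hA := posDef_state hα hlam I k
  have h := (mul_gram_inv_quadForm_le_log_det hA hα.le (s.jac (I k) (s.iter I k))
    (s.lossGrad (I k) (s.iter I k))).trans
    (mul_le_mul_of_nonneg_left (hs.lossGrad_dotProduct_le (I k) (hs.iter_mem I k))
      (log_det_add_gram_div_det_nonneg hA hα.le _))
  rw [← state_snd_succ] at h
  change s.α * s.gradQuad I k ≤ _ at h
  rw [div_mul_eq_mul_div, le_div_iff₀ hα]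
  linarith

theorem Regular.sum_gradQuad_le (hs : s.Regular ν Lℓ G E) (hα : 0 < s.α) (hlam : 0 < s.lam)
    (I : ℕ → Finset (Fin n)) {γ : ℝ} (hγ : 0 ≤ γ) (k : ℕ) (hI : ∀ t ≤ k, (I t).card = s.B)
    (hγG : s.α * γ * (s.B * G ^ 2) ≤ s.lam) :
    ∑ t ∈ Finset.range (k + 1), s.gradQuad I t
      ≤ s.B * Lℓ ^ 2 / s.α * (s.logDet I k + 1 / (γ + 1)) := by
  induction k with
  | zero =>
    have h := hs.gradQuad_zero_le hα hlam I hγ (by rwa [hI 0 le_rfl])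
    rw [hI 0 le_rfl] at h
    simpa [logDet_zero hα hlam] using h
  | succ k ih =>
    have h1 := ih fun t ht => hI t (by omega)
    have h2 := hs.gradQuad_le_log_det hα hlam I (k + 1)
    rw [hI _ le_rfl] at h2
    rw [Finset.sum_range_succ, logDet_succ hα hlam]
    linarith

/-- The distance to `v` after `k` steps is measured in `H_{k-1}`, the matrix stored in `state I k`;
for `k = 0` this is `λI`. -/
theorem Regular.telescope (hs : s.Regular ν Lℓ G E) (hα : 0 < s.α) (hlam : 0 < s.lam)
    (hην : 2 * s.α ≤ s.η * ν) (hη : 0 < s.η) {v : Param d m L} (hv : v ∈ s.C)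
    (I : ℕ → Finset (Fin n)) (k : ℕ) (hI : ∀ t < k, (I t).card = s.B) :
    sqNorm (s.state I k).2 (v - s.iter I k) + 2 * s.η * ∑ t ∈ Finset.range k, ∑ j ∈ I t,
        (s.sampleLoss (s.iter I t) j - s.sampleLoss v j)
      ≤ s.lam * ‖v - s.w₀‖ ^ 2 + k * (s.B * (2 * s.η * Lℓ * E + 2 * s.α * E ^ 2))
        + s.η ^ 2 * ∑ t ∈ Finset.range k, s.gradQuad I t := by
  induction k with
  | zero =>
    simp only [Finset.range_zero, Finset.sum_empty, mul_zero, add_zero, Nat.cast_zero, zero_mul]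
    refine le_of_eq ?_
    rw [sqNorm, state, smul_mulVec, one_mulVec, dotProduct_smul, smul_eq_mul,
      EuclideanSpace.real_norm_sq_eq]
    simp only [dotProduct, sq]
    rfl
  | succ k ih =>
    have h1 := ih fun t ht => hI t (by omega)
    have h2 := hs.step_le hα hην hη (posDef_state hα hlam I k) (hs.iter_mem I k) hv (I k)
      (state_snd_succ I k) (p := s.iter I (k + 1)) (by
        rw [state_fst_succ]
        exact isMetricProj_metricProj hs.isCompact ⟨_, hs.init_mem⟩ _ _)
    rw [hI k (by omega)] at h2
    change _ ≤ _ + s.η ^ 2 * s.gradQuad I k at h2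
    rw [Finset.sum_range_succ, Finset.sum_range_succ, Nat.cast_succ]
    linarith

/-- The regret bound for `k ≥ 1` steps. -/
theorem Regular.regret_le (hs : s.Regular ν Lℓ G E) (hα : 0 < s.α) (hlam : 0 < s.lam)
    (hην : 2 * s.α ≤ s.η * ν) (hη : 0 < s.η) {v : Param d m L} (hv : v ∈ s.C)
    (I : ℕ → Finset (Fin n)) {γ : ℝ} (hγ : 0 ≤ γ) (hγG : s.α * γ * (s.B * G ^ 2) ≤ s.lam)
    (k : ℕ) (hk : 0 < k) (hI : ∀ t < k, (I t).card = s.B) :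
    2 * s.η * ∑ t ∈ Finset.range k, ∑ j ∈ I t,
        (s.sampleLoss (s.iter I t) j - s.sampleLoss v j)
      ≤ s.lam * Metric.diam s.C ^ 2 + k * (s.B * (2 * s.η * Lℓ * E + 2 * s.α * E ^ 2))
        + s.η ^ 2 * (s.B * Lℓ ^ 2 / s.α * (s.logDet I k + 1 / (γ + 1))) := by
  have h1 := hs.telescope hα hlam hην hη hv I k hI
  have h2 : 0 ≤ sqNorm (s.state I k).2 (v - s.iter I k) :=
    (posDef_state hα hlam I k).posSemidef.dotProduct_mulVec_nonneg _
  have h3 : ‖v - s.w₀‖ ^ 2 ≤ Metric.diam s.C ^ 2 := by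
    rw [← dist_eq_norm]
    exact pow_le_pow_left₀ dist_nonneg
      (Metric.dist_le_diam_of_mem hs.isCompact.isBounded hv hs.init_mem) 2
  obtain ⟨k, rfl⟩ := Nat.exists_eq_succ_of_ne_zero hk.ne'
  have h4 := hs.sum_gradQuad_le hα hlam I hγ k (fun t ht => hI t (by omega)) hγG
  -- The steps `0, …, k` only involve matrices up to `H_k`; monotonicity of `logDet` passes to the
  -- larger index of the claim.
  have h5 : s.B * Lℓ ^ 2 / s.α * (s.logDet I k + 1 / (γ + 1))
      ≤ s.B * Lℓ ^ 2 / s.α * (s.logDet I (k + 1) + 1 / (γ + 1)) :=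
    mul_le_mul_of_nonneg_left (by linarith [logDet_le_succ hα hlam I k]) (by positivity)
  have h6 := mul_le_mul_of_nonneg_left (h4.trans h5) (sq_nonneg s.η)
  have h7 := mul_le_mul_of_nonneg_left h3 hlam.le
  rw [Nat.succ_eq_add_one] at h1 ⊢
  linarith

end Setup

end SGN

namespace SGN

/-! ### Expectations over uniform mini-batches -/

/-- `F` depends only on the first `k` terms of a sequence. -/
def DependsOnPrefix {α β : Type*} (k : ℕ) (F : (ℕ → α) → β) : Prop :=
  ∀ I I' : ℕ → α, (∀ i < k, I i = I' i) → F I = F I'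

/-- Extend a finite prefix of batches by empty batches. -/
def extendPrefix {n : ℕ} (k : ℕ) (y : Finset.range k → Finset (Fin n)) (i : ℕ) : Finset (Fin n) :=
  if h : i ∈ Finset.range k then y ⟨i, h⟩ else ∅

theorem DependsOnPrefix.eq_extendPrefix {Ω β : Type*} {n k : ℕ} {I : ℕ → Ω → Finset (Fin n)}
    {F : (ℕ → Finset (Fin n)) → β} (hF : DependsOnPrefix k F) (ω : Ω) :
    F (fun i => I i ω) = F (extendPrefix k fun i : Finset.range k => I i ω) :=
  hF _ _ fun i hi => by simp [extendPrefix, hi]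

namespace IsUniformMinibatch

variable {Ω : Type*} [MeasurableSpace Ω] {P : Measure Ω} {n B : ℕ}
  {I : ℕ → Ω → Finset (Fin n)}

theorem measurable_top (hI : IsUniformMinibatch P B I) (k : ℕ) :
    Measurable[_, (⊤ : MeasurableSpace (Finset (Fin n)))] (I k) := by
  let _ : MeasurableSpace (Finset (Fin n)) := ⊤
  exact measurable_to_countable' (hI.measurable k)

theorem measurable_prefix (hI : IsUniformMinibatch P B I) (k : ℕ) :
    Measurable[_, MeasurableSpace.pi (m := fun _ => (⊤ : MeasurableSpace (Finset (Fin n))))]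
      (fun ω (i : Finset.range k) => I i ω) := by
  let _ : MeasurableSpace (Finset (Fin n)) := ⊤
  exact measurable_pi_lambda _ fun i => hI.measurable_top i

/-- A finite prefix of batches takes values in a finite type, where every function is measurable and
bounded. Hence no measurability of the metric projection, a choice of minimizer, is needed. -/
theorem integrable [IsProbabilityMeasure P] (hI : IsUniformMinibatch P B I) {k : ℕ}
    {F : (ℕ → Finset (Fin n)) → ℝ}
    (hF : DependsOnPrefix k F) : Integrable (fun ω => F fun i => I i ω) P := by
  let _ : MeasurableSpace (Finset (Fin n)) := ⊤
  simp only [hF.eq_extendPrefix]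
  have hY := hI.measurable_prefix k
  have := Measure.isProbabilityMeasure_map (μ := P) hY.aemeasurable
  exact (Integrable.of_finite (μ := P.map fun ω (i : Finset.range k) => I i ω)
    (f := fun y => F (extendPrefix k y))).comp_measurable hY

theorem measure_union (hI : IsUniformMinibatch P B I) (k : ℕ) {T : Finset (Finset (Fin n))}
    (hT : ∀ M ∈ T, M.card = B) :
    P (I k ⁻¹' T) = (T.card : ENNReal) * ((n.choose B : ℕ) : ENNReal)⁻¹ := by
  have h1 : I k ⁻¹' (T : Set (Finset (Fin n))) = ⋃ M ∈ T, I k ⁻¹' {M} := by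
    ext ω; simp
  rw [h1, measure_biUnion_finset ?_ fun M _ => hI.measurable k M,
    Finset.sum_congr rfl fun M hM => hI.law k M (hT M hM), Finset.sum_const, nsmul_eq_mul]
  intro M _ M' _ hne
  exact Set.disjoint_left.2 fun ω h h' => hne (h.symm.trans h')

/-- The sets of size `B` already carry total mass `(n choose B) · (n choose B)⁻¹ = 1`. -/
theorem ae_card_eq [IsProbabilityMeasure P] (hI : IsUniformMinibatch P B I) (hB : B ≤ n) (k : ℕ) :
    ∀ᵐ ω ∂P, (I k ω).card = B := by
  have h := hI.measure_union k (T := Finset.powersetCard B Finset.univ) fun M hM =>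
    (Finset.mem_powersetCard.1 hM).2
  have hc : ((n.choose B : ℕ) : ENNReal) ≠ 0 := by
    exact_mod_cast (Nat.choose_pos hB).ne'
  rw [Finset.card_powersetCard, Finset.card_fin,
    ENNReal.mul_inv_cancel hc (ENNReal.natCast_ne_top _)] at h
  have hm : MeasurableSet (I k ⁻¹' (Finset.powersetCard B Finset.univ :
      Finset (Finset (Fin n)))) := by
    let _ : MeasurableSpace (Finset (Fin n)) := ⊤
    exact hI.measurable_top k trivial
  rw [prob_compl_eq_zero_iff hm |>.symm] at h
  filter_upwards [measure_eq_zero_iff_ae_notMem.1 h] with ω hω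
  simpa using hω

/-- There are `(n-1 choose B-1)` sets of size `B` containing `j`, and `n (n-1 choose B-1) = B (n
choose B)`. -/
theorem measureReal_mem [IsProbabilityMeasure P] (hI : IsUniformMinibatch P B I) (hB₀ : 0 < B)
    (hB : B ≤ n) (k : ℕ) (j : Fin n) : P.real {ω | j ∈ I k ω} = B / n := by
  have hn : 0 < n := hB₀.trans_le hB
  have h := hI.measure_union k
    (T := {M ∈ Finset.powersetCard B Finset.univ | {j} ⊆ M}) fun M hM =>
    (Finset.mem_powersetCard.1 (Finset.mem_filter.1 hM).1).2
  rw [Finset.card_filter_powersetCard_subset _ _ _ (Finset.subset_univ _)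
      (by simpa [Nat.one_le_iff_ne_zero] using hB₀.ne'),
    Finset.card_singleton, Finset.card_fin] at h
  have hae : P {ω | j ∈ I k ω} = P (I k ⁻¹'
      ({M ∈ Finset.powersetCard B Finset.univ | {j} ⊆ M} : Finset (Finset (Fin n)))) := by
    refine measure_congr ?_
    filter_upwards [hI.ae_card_eq hB k] with ω hω
    refine propext ?_
    change j ∈ I k ω ↔ I k ω ∈ (({M ∈ Finset.powersetCard B Finset.univ | {j} ⊆ M} :
      Finset (Finset (Fin n))) : Set (Finset (Fin n)))
    simp [hω]
  rw [Measure.real, hae, h, ENNReal.toReal_mul, ENNReal.toReal_inv, ENNReal.toReal_natCast,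
    ENNReal.toReal_natCast]
  have hc : ((n.choose B : ℕ) : ℝ) ≠ 0 := by exact_mod_cast (Nat.choose_pos hB).ne'
  have hn' : (n : ℝ) ≠ 0 := by exact_mod_cast hn.ne'
  rw [← div_eq_mul_inv, div_eq_div_iff hc hn']
  obtain ⟨n, rfl⟩ := Nat.exists_eq_succ_of_ne_zero hn.ne'
  obtain ⟨B, rfl⟩ := Nat.exists_eq_succ_of_ne_zero hB₀.ne'
  have := Nat.add_one_mul_choose_eq n B
  simp only [Nat.succ_eq_add_one, Nat.add_sub_cancel]
  rw [mul_comm, mul_comm ((B + 1 : ℕ) : ℝ)]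
  exact_mod_cast this

/-- The batch sum of quantities determined by the previous batches has mean `B / n` times the mean
of the full sum. -/
theorem integral_sum_mem [IsProbabilityMeasure P] (hI : IsUniformMinibatch P B I) (hB₀ : 0 < B)
    (hB : B ≤ n) (k : ℕ) {f : (ℕ → Finset (Fin n)) → Fin n → ℝ} (hf : DependsOnPrefix k f) :
    ∫ ω, ∑ j ∈ I k ω, f (fun i => I i ω) j ∂P
      = B / n * ∫ ω, ∑ j, f (fun i => I i ω) j ∂P := by
  let _ : MeasurableSpace (Finset (Fin n)) := ⊤
  have hfj : ∀ j, DependsOnPrefix k fun I => f I j := fun j I I' h => congrFun (hf I I' h) j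
  have hind : DependsOnPrefix (k + 1) fun I : ℕ → Finset (Fin n) => I k := fun I I' h =>
    h k (Nat.lt_succ_self k)
  have hsum : ∀ ω, ∑ j ∈ I k ω, f (fun i => I i ω) j
      = ∑ j, (if j ∈ I k ω then (1 : ℝ) else 0) * f (fun i => I i ω) j := fun ω => by
    simp
  have hint : ∀ j, Integrable
      (fun ω => (if j ∈ I k ω then (1 : ℝ) else 0) * f (fun i => I i ω) j) P := fun j =>
    hI.integrable (k := k + 1) (F := fun I => (if j ∈ I k then (1 : ℝ) else 0) * f I j)
      fun I I' h => by
        simp only [hind I I' h, hfj j I I' fun i hi => h i (by omega)]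
  simp only [hsum]
  rw [integral_finsetSum _ fun j _ => hint j, integral_finsetSum _ fun j _ => hI.integrable (hfj j),
    Finset.mul_sum]
  refine Finset.sum_congr rfl fun j _ => ?_
  -- `f` is a function of the batches before `k`, hence independent of the indicator of `j ∈ I k`,
  -- and the expectation of the product factors.
  have hindep : IndepFun (fun ω (i : ({k} : Finset ℕ)) => I i ω)
      (fun ω (i : Finset.range k) => I i ω) P :=
    hI.indep.indepFun_finset {k} (Finset.range k) (by simp) hI.measurable_top
  have hX : Measurable (fun ω (i : ({k} : Finset ℕ)) => I i ω) :=
    measurable_pi_lambda _ fun i => hI.measurable_top i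
  have hmul := hindep.integral_fun_comp_mul_comp hX.aemeasurable
    (hI.measurable_prefix k).aemeasurable
    (f := fun x => if j ∈ x ⟨k, Finset.mem_singleton_self k⟩ then (1 : ℝ) else 0)
    (g := fun y => f (extendPrefix k y) j) .of_discrete .of_discrete
  have hprob : ∫ ω, (if j ∈ I k ω then (1 : ℝ) else 0) ∂P = B / n := by
    have hm : MeasurableSet {ω | j ∈ I k ω} := hI.measurable_top k (t := {M | j ∈ M}) trivial
    rw [← hI.measureReal_mem hB₀ hB k j, ← integral_indicator_one hm]
    exact integral_congr_ae (.of_forall fun ω => by simp [Set.indicator_apply])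
  simp only [(hfj j).eq_extendPrefix]
  rw [← hprob]
  exact hmul

end IsUniformMinibatch

end SGN

namespace SGN

/-! ### First-order consequences of the loss assumptions -/

/-- The tangent-line inequality for the convex function `f x - (ν/2) x²`. -/
theorem _root_.StrongConvexOn.add_deriv_mul_sub_add_le {f : ℝ → ℝ} {ν : ℝ}
    (hf : StrongConvexOn Set.univ ν f) (hd : Differentiable ℝ f) (u v : ℝ) :
    f u + deriv f u * (v - u) + ν / 2 * (v - u) ^ 2 ≤ f v := by
  have hg := strongConvexOn_iff_convex.1 hf
  have hgd : ∀ u, HasDerivAt (fun x => f x - ν / 2 * ‖x‖ ^ 2) (deriv f u - ν * u) u := by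
    intro u
    simp only [Real.norm_eq_abs, sq_abs]
    refine ((hd u).hasDerivAt.sub ((hasDerivAt_pow 2 u).const_mul (ν / 2))).congr_deriv ?_
    norm_num
    ring
  rcases lt_trichotomy u v with h | rfl | h
  · have h1 := hg.le_slope_of_hasDerivAt (Set.mem_univ _) (Set.mem_univ _) h (hgd u)
    rw [slope_def_field, le_div_iff₀ (sub_pos.2 h)] at h1
    simp only [Real.norm_eq_abs, sq_abs] at h1
    linarith
  · simp
  · have h1 := hg.slope_le_of_hasDerivAt (Set.mem_univ _) (Set.mem_univ _) h (hgd u)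
    rw [slope_def_field, div_le_iff₀ (sub_pos.2 h)] at h1
    simp only [Real.norm_eq_abs, sq_abs] at h1
    linarith

/-- The point `u` may be an endpoint, so the derivative is taken as a limit of slopes within the
interval; `a < b` makes `u` an accumulation point. -/
theorem abs_deriv_le_of_abs_sub_le {f : ℝ → ℝ} {a b c u : ℝ} (hab : a < b)
    (hu : u ∈ Set.Icc a b) (hd : DifferentiableAt ℝ f u)
    (h : ∀ v ∈ Set.Icc a b, |f v - f u| ≤ c * |v - u|) : |deriv f u| ≤ c := by
  have hne : (nhdsWithin u (Set.Icc a b \ {u})).NeBot :=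
    accPt_principal_iff_nhdsWithin.1
      (uniqueDiffWithinAt_iff_accPt.1 ((uniqueDiffOn_Icc hab) u hu))
  have ht := hasDerivWithinAt_iff_tendsto_slope.1
    (hd.hasDerivAt.hasDerivWithinAt (s := Set.Icc a b))
  refine le_of_tendsto ht.abs ?_
  filter_upwards [self_mem_nhdsWithin] with v hv
  have hvu : 0 < |v - u| := abs_pos.2 (sub_ne_zero.2 hv.2)
  rw [slope_def_field, abs_div, div_le_iff₀ hvu]
  exact h v hv.1

/-! ### Suprema over the parameter set -/

section Sup

variable {d m L : ℕ} {σ : ℝ → ℝ} {σ₀ σ₁ σ₂ κ₀ ζ₀ r₀ : ℝ} {C : Set (Param d m L)}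
  {w₀ : Param d m L}

/-- The hypotheses on the activation, the parameter set and the initial parameter. -/
structure IsRegion (σ : ℝ → ℝ) (σ₀ σ₁ σ₂ κ₀ ζ₀ r₀ : ℝ) (C : Set (Param d m L))
    (w₀ : Param d m L) : Prop where
  width_pos : 0 < m
  activation : IsActivation σ σ₀ σ₁ σ₂
  isCompact : IsCompact C
  init_mem : w₀ ∈ C
  kappaInit_le : kappaInit w₀ ≤ κ₀
  norm_weightOut_le : ‖weightOut w₀‖ ≤ ζ₀
  diam_le : Metric.diam C ≤ r₀

/-- The square root of the constant in the width estimate. -/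
def hessConst (L : ℕ) (σ₀ σ₁ σ₂ κ₀ ζ₀ r₀ : ℝ) : ℝ :=
  (ζ₀ + r₀) * (jetConst σ₁ σ₂ (κ₀ + r₀) (max 1 σ₀) L).2 +
    2 * (jetConst σ₁ σ₂ (κ₀ + r₀) (max 1 σ₀) L).1

theorem IsRegion.jetBound (hR : IsRegion σ σ₀ σ₁ σ₂ κ₀ ζ₀ r₀ C w₀) {w : Param d m L} (hw : w ∈ C)
    {x : EuclideanSpace ℝ (Fin d)} (hx : ‖x‖ ≤ 1) :
    JetBound (net σ x : Param d m L → ℝ) w ((ζ₀ + r₀) * max 1 σ₀)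
      ((ζ₀ + r₀) * (jetConst σ₁ σ₂ (κ₀ + r₀) (max 1 σ₀) L).1 + max 1 σ₀)
      (hessConst L σ₀ σ₁ σ₂ κ₀ ζ₀ r₀ / √(m : ℝ)) := by
  refine jetBound_net hR.activation hR.width_pos hR.kappaInit_le hR.norm_weightOut_le ?_ hx
  rw [← dist_eq_norm]
  exact (Metric.dist_le_diam_of_mem hR.isCompact.isBounded hw hR.init_mem).trans hR.diam_le

/-- The bound `b` only ensures that the set is bounded above; the real `sSup` of an unbounded set
would be `0`. -/
theorem le_sSup_image_prod {f : Param d m L × EuclideanSpace ℝ (Fin d) → ℝ} {b : ℝ}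
    (hb : ∀ w ∈ C, ∀ x : EuclideanSpace ℝ (Fin d), ‖x‖ ≤ 1 → f (w, x) ≤ b) {w : Param d m L}
    (hw : w ∈ C) {x : EuclideanSpace ℝ (Fin d)} (hx : ‖x‖ ≤ 1) :
    f (w, x) ≤ sSup (f '' (C ×ˢ Metric.closedBall 0 1)) := by
  refine le_csSup ⟨b, ?_⟩ ⟨(w, x), ⟨hw, by simpa using hx⟩, rfl⟩
  rintro _ ⟨⟨w', x'⟩, ⟨hw', hx'⟩, rfl⟩
  exact hb w' hw' x' (by simpa using hx')

theorem IsRegion.abs_net_le (hR : IsRegion σ σ₀ σ₁ σ₂ κ₀ ζ₀ r₀ C w₀) {w : Param d m L}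
    (hw : w ∈ C) {x : EuclideanSpace ℝ (Fin d)} (hx : ‖x‖ ≤ 1) : |net σ x w| ≤ supNet σ C :=
  le_sSup_image_prod (f := fun q : Param d m L × EuclideanSpace ℝ (Fin d) => |net σ q.2 q.1|)
    (fun _ hw' _ hx' => (hR.jetBound hw' hx').value) hw hx

theorem IsRegion.norm_gradNet_le (hR : IsRegion σ σ₀ σ₁ σ₂ κ₀ ζ₀ r₀ C w₀) {w : Param d m L}
    (hw : w ∈ C) {x : EuclideanSpace ℝ (Fin d)} (hx : ‖x‖ ≤ 1) : ‖gradNet σ x w‖ ≤ lipNet σ C :=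
  le_sSup_image_prod (f := fun q : Param d m L × EuclideanSpace ℝ (Fin d) => ‖gradNet σ q.2 q.1‖)
    (fun _ hw' _ hx' => (norm_gradNet _ _ _).trans_le (hR.jetBound hw' hx').deriv) hw hx

theorem IsRegion.norm_hessNet_le (hR : IsRegion σ σ₀ σ₁ σ₂ κ₀ ζ₀ r₀ C w₀) {w : Param d m L}
    (hw : w ∈ C) {x : EuclideanSpace ℝ (Fin d)} (hx : ‖x‖ ≤ 1) : ‖hessNet σ x w‖ ≤ lipGrad σ C :=
  le_sSup_image_prod (f := fun q : Param d m L × EuclideanSpace ℝ (Fin d) => ‖hessNet σ q.2 q.1‖)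
    (fun _ hw' _ hx' => (norm_hessNet _ _ _).trans_le (hR.jetBound hw' hx').deriv2) hw hx

theorem lipGrad_nonneg : 0 ≤ lipGrad σ C :=
  Real.sSup_nonneg (by rintro _ ⟨q, -, rfl⟩; exact norm_nonneg _)

theorem lipNet_nonneg : 0 ≤ lipNet σ C :=
  Real.sSup_nonneg (by rintro _ ⟨q, -, rfl⟩; exact norm_nonneg _)

theorem supNet_nonneg : 0 ≤ supNet σ C :=
  Real.sSup_nonneg (by rintro _ ⟨q, -, rfl⟩; exact abs_nonneg _)

theorem IsRegion.sq_lipGrad_le (hR : IsRegion σ σ₀ σ₁ σ₂ κ₀ ζ₀ r₀ C w₀) :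
    lipGrad σ C ^ 2 ≤ hessConst L σ₀ σ₁ σ₂ κ₀ ζ₀ r₀ ^ 2 / m := by
  have h : lipGrad σ C ≤ hessConst L σ₀ σ₁ σ₂ κ₀ ζ₀ r₀ / √(m : ℝ) := by
    refine csSup_le ⟨_, (w₀, 0), ⟨hR.init_mem, by simp⟩, rfl⟩ ?_
    rintro _ ⟨⟨w, x⟩, ⟨hw, hx⟩, rfl⟩
    exact (norm_hessNet _ _ _).trans_le (hR.jetBound hw (by simpa using hx)).deriv2
  calc lipGrad σ C ^ 2 ≤ (hessConst L σ₀ σ₁ σ₂ κ₀ ζ₀ r₀ / √(m : ℝ)) ^ 2 :=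
        pow_le_pow_left₀ lipGrad_nonneg h 2
    _ = _ := by rw [div_pow, Real.sq_sqrt (Nat.cast_nonneg _)]

theorem fderiv_net_apply (x : EuclideanSpace ℝ (Fin d)) (w v : Param d m L) :
    fderiv ℝ (net σ x) w v = inner ℝ (gradNet σ x w) v := by
  rw [gradNet_eq, InnerProductSpace.toDual_symm_apply]

/-- The mean value inequality twice: the Hessian bound limits the variation of the derivative on `C`
by `Lip_∇φ r_C`, and this limits the linearization error. -/
theorem IsRegion.linearization_le (hR : IsRegion σ σ₀ σ₁ σ₂ κ₀ ζ₀ r₀ C w₀) (hC : Convex ℝ C)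
    {w v : Param d m L} (hw : w ∈ C) (hv : v ∈ C) {x : EuclideanSpace ℝ (Fin d)} (hx : ‖x‖ ≤ 1) :
    |net σ x v - net σ x w - inner ℝ (gradNet σ x w) (v - w)|
      ≤ lipGrad σ C * Metric.diam C ^ 2 := by
  have hcd := (hR.jetBound hw hx).contDiff
  have hdist : ∀ {u v}, u ∈ C → v ∈ C → ‖u - v‖ ≤ Metric.diam C := fun hu hv => by
    rw [← dist_eq_norm]
    exact Metric.dist_le_diam_of_mem hR.isCompact.isBounded hu hv
  have h1 : ∀ u ∈ C, ‖fderiv ℝ (net σ x) u - fderiv ℝ (net σ x) w‖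
      ≤ lipGrad σ C * Metric.diam C := fun u hu =>
    (hC.norm_image_sub_le_of_norm_fderiv_le (𝕜 := ℝ) (f := fderiv ℝ (net σ x))
      (fun y _ => (hcd.fderiv_right (m := 1) (by norm_num)).differentiable (by norm_num) y)
      (fun y hy => (norm_hessNet _ _ _).symm.trans_le (hR.norm_hessNet_le hy hx)) hw hu).trans
      (mul_le_mul_of_nonneg_left (hdist hu hw) lipGrad_nonneg)
  have h2 := hC.norm_image_sub_le_of_norm_fderiv_le' (𝕜 := ℝ) (f := net σ x)
    (fun y _ => hcd.differentiable (by norm_num) y) h1 hw hv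
  rw [fderiv_net_apply] at h2
  refine h2.trans ?_
  rw [sq, ← mul_assoc]
  exact mul_le_mul_of_nonneg_left (hdist hv hw) (mul_nonneg lipGrad_nonneg Metric.diam_nonneg)

theorem IsRegion.net_eq_of_lipNet_eq_zero (hR : IsRegion σ σ₀ σ₁ σ₂ κ₀ ζ₀ r₀ C w₀)
    (hC : Convex ℝ C) (h0 : lipNet σ C = 0) {w v : Param d m L} (hw : w ∈ C) (hv : v ∈ C)
    {x : EuclideanSpace ℝ (Fin d)} (hx : ‖x‖ ≤ 1) : net σ x v = net σ x w := by
  have h := hC.norm_image_sub_le_of_norm_fderiv_le (𝕜 := ℝ) (f := net σ x) (C := 0)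
    (fun y _ => (hR.jetBound hw hx).contDiff.differentiable (by norm_num) y)
    (fun y hy => (norm_gradNet _ _ _).symm.trans_le (h0 ▸ hR.norm_gradNet_le hy hx)) hw hv
  rw [zero_mul, norm_le_zero_iff, sub_eq_zero] at h
  exact h

end Sup

namespace Setup

variable {d m L n : ℕ} {s : Setup d m L n} {ν Lℓ G E : ℝ}

/-! ### The optimality gap -/

theorem risk_eq (w : Param d m L) : s.risk w = 1 / (n : ℝ) * ∑ j, s.sampleLoss w j := rfl

theorem exists_gap_eq (hC : IsCompact s.C) (hw₀ : s.w₀ ∈ s.C)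
    (hnet : ∀ j, Continuous (net s.σ (s.z j).1 : Param d m L → ℝ))
    (hloss : ∀ j, Continuous fun u => s.loss u (s.z j)) :
    ∃ v ∈ s.C, ∀ w, s.gap w = 1 / (n : ℝ) * ∑ j, (s.sampleLoss w j - s.sampleLoss v j) := by
  have hcont : Continuous s.risk :=
    continuous_const.mul (continuous_finsetSum _ fun j _ => (hloss j).comp (hnet j))
  obtain ⟨v, hv, hmin⟩ := hC.exists_sInf_image_eq ⟨_, hw₀⟩ hcont.continuousOn
  refine ⟨v, hv, fun w => ?_⟩
  rw [gap, hmin, risk_eq, risk_eq, Finset.sum_sub_distrib, mul_sub]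

theorem avgIter_mem (hC : IsCompact s.C) (hconv : Convex ℝ s.C) (hw₀ : s.w₀ ∈ s.C)
    (I : ℕ → Finset (Fin n)) {k : ℕ} (hk : 0 < k) : s.avgIter I k ∈ s.C := by
  have hk' : (k : ℝ) ≠ 0 := by exact_mod_cast hk.ne'
  rw [avgIter, Finset.smul_sum]
  exact hconv.sum_mem (fun _ _ => by positivity) (by simp [hk']) fun t _ => iter_mem hC hw₀ I t

/-- A Jensen inequality with error: `φ` is not affine in `w`, so convexity of the loss is used along
the linearization of `φ` at the average. -/
theorem Regular.sampleLoss_avgIter_le (hs : s.Regular ν Lℓ G E) (hν : 0 ≤ ν)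
    (I : ℕ → Finset (Fin n)) {k : ℕ} (hk : 0 < k) (j : Fin n) :
    s.sampleLoss (s.avgIter I k) j
      ≤ 1 / (k : ℝ) * ∑ t ∈ Finset.range k, s.sampleLoss (s.iter I t) j + Lℓ * E := by
  have hk' : (0 : ℝ) < k := by exact_mod_cast hk
  have hmem := avgIter_mem hs.isCompact hs.convex hs.init_mem I hk
  set a := s.avgIter I k with ha
  -- The deviations from the average sum to zero, so the first-order terms cancel.
  have hsum : ∑ t ∈ Finset.range k, inner ℝ (gradNet s.σ (s.z j).1 a) (s.iter I t - a) = 0 := by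
    rw [← inner_sum, Finset.sum_sub_distrib, Finset.sum_const, Finset.card_range, ha, avgIter,
      ← Nat.cast_smul_eq_nsmul ℝ k, smul_smul, mul_one_div_cancel hk'.ne', one_smul, sub_self,
      inner_zero_right]
  have hterm : ∀ t ∈ Finset.range k, s.sampleLoss a j
      + deriv (fun u => s.loss u (s.z j)) (net s.σ (s.z j).1 a)
        * inner ℝ (gradNet s.σ (s.z j).1 a) (s.iter I t - a) - Lℓ * E
      ≤ s.sampleLoss (s.iter I t) j := by
    intro t _
    have h1 := hs.loss_ge j (net s.σ (s.z j).1 a) (net s.σ (s.z j).1 (s.iter I t))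
    have h2 := hs.linearization_le j a hmem _ (hs.iter_mem I t)
    have h3 := hs.abs_deriv_loss_le j a hmem
    simp only [sampleLoss]
    set g := deriv (fun u => s.loss u (s.z j)) (net s.σ (s.z j).1 a)
    set b := inner ℝ (gradNet s.σ (s.z j).1 a) (s.iter I t - a)
    set δ := net s.σ (s.z j).1 (s.iter I t) - net s.σ (s.z j).1 a
    have h4 : g * (b - δ) ≤ Lℓ * E := by
      refine (le_abs_self _).trans ?_
      rw [abs_mul, abs_sub_comm]
      exact mul_le_mul h3 h2 (abs_nonneg _) ((abs_nonneg _).trans h3)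
    have h5 : 0 ≤ ν / 2 * δ ^ 2 := by positivity
    linarith
  have h := Finset.sum_le_sum hterm
  rw [Finset.sum_sub_distrib, Finset.sum_add_distrib, ← Finset.mul_sum, hsum, Finset.sum_const,
    Finset.sum_const, Finset.card_range, nsmul_eq_mul, nsmul_eq_mul] at h
  rw [← sub_le_iff_le_add, one_div, ← div_eq_inv_mul, le_div_iff₀ hk']
  linarith

theorem Regular.gap_avgIter_le (hs : s.Regular ν Lℓ G E) (hν : 0 ≤ ν) (hn : 0 < n)
    (I : ℕ → Finset (Fin n)) {k : ℕ} (hk : 0 < k) :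
    s.gap (s.avgIter I k) ≤ 1 / (k : ℝ) * ∑ t ∈ Finset.range k, s.gap (s.iter I t) + Lℓ * E := by
  have hk' : (k : ℝ) ≠ 0 := by exact_mod_cast hk.ne'
  have hn' : (n : ℝ) ≠ 0 := by exact_mod_cast hn.ne'
  have h := Finset.sum_le_sum fun j (_ : j ∈ Finset.univ) => hs.sampleLoss_avgIter_le hν I hk j
  rw [Finset.sum_add_distrib, Finset.sum_const, Finset.card_univ, Fintype.card_fin, nsmul_eq_mul,
    ← Finset.mul_sum, Finset.sum_comm] at h
  have h1 := mul_le_mul_of_nonneg_left h (show 0 ≤ 1 / (n : ℝ) by positivity)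
  simp only [gap, Finset.sum_sub_distrib, risk_eq, ← Finset.mul_sum, Finset.sum_const,
    Finset.card_range, nsmul_eq_mul]
  rw [mul_add, ← mul_assoc (1 / (n : ℝ)) n, one_div_mul_cancel hn', one_mul] at h1
  rw [mul_sub, ← mul_assoc (1 / (k : ℝ)) k, one_div_mul_cancel hk', one_mul,
    mul_left_comm (1 / (k : ℝ))]
  linarith

/-! ### Dependence on the batches -/

theorem state_dependsOnPrefix (s : Setup d m L n) (k : ℕ) :
    DependsOnPrefix k fun I => s.state I k := by
  induction k with
  | zero => exact fun _ _ _ => rfl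
  | succ k ih =>
    intro I I' h
    have h1 : s.state I k = s.state I' k := ih I I' fun i hi => h i (by omega)
    simp only [state, h1]
    rw [h k (Nat.lt_succ_self k)]

theorem iter_dependsOnPrefix (s : Setup d m L n) {k t : ℕ} (ht : t ≤ k) :
    DependsOnPrefix k fun I => s.iter I t := fun I I' h =>
  congrArg Prod.fst (s.state_dependsOnPrefix t I I' fun i hi => h i (by omega))

theorem avgIter_dependsOnPrefix (s : Setup d m L n) (k : ℕ) :
    DependsOnPrefix k fun I => s.avgIter I k := fun I I' h => by
  simp only [avgIter]
  rw [Finset.sum_congr rfl fun t ht => s.iter_dependsOnPrefix (Finset.mem_range.1 ht).le I I' h]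

theorem logDet_dependsOnPrefix (s : Setup d m L n) (k : ℕ) :
    DependsOnPrefix (k + 1) fun I => s.logDet I k := fun I I' h => by
  have h1 : s.state I (k + 1) = s.state I' (k + 1) := s.state_dependsOnPrefix (k + 1) I I' h
  have h2 : s.state I 1 = s.state I' 1 :=
    s.state_dependsOnPrefix 1 I I' fun i hi => h i (by omega)
  simp only [logDet, precond, zero_add, h1, h2]

end Setup

theorem DependsOnPrefix.comp {α β γ : Type*} {k : ℕ} {F : (ℕ → α) → β} (hF : DependsOnPrefix k F)
    (g : β → γ) : DependsOnPrefix k fun I => g (F I) := fun I I' h => congrArg g (hF I I' h)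

/-! ### The expected regret -/

namespace Setup

variable {d m L n : ℕ} {s : Setup d m L n} {ν Lℓ G E : ℝ} {Ω : Type*} [MeasurableSpace Ω]
  {P : Measure Ω} [IsProbabilityMeasure P] {I : ℕ → Ω → Finset (Fin n)}

/-- The bound on the expected regret. -/
theorem Regular.sum_integral_gap_le (hs : s.Regular ν Lℓ G E) (hI : IsUniformMinibatch P s.B I)
    (hB₀ : 0 < s.B) (hB : s.B ≤ n) {v : Param d m L} (hv : v ∈ s.C)
    (hgap : ∀ w, s.gap w = 1 / (n : ℝ) * ∑ j, (s.sampleLoss w j - s.sampleLoss v j))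
    (hα : 0 < s.α) (hlam : 0 < s.lam) (hην : 2 * s.α ≤ s.η * ν) (hη : 0 < s.η) {γ : ℝ}
    (hγ : 0 ≤ γ) (hγG : s.α * γ * (s.B * G ^ 2) ≤ s.lam) {k : ℕ} (hk : 0 < k) :
    2 * s.η * (s.B * ∑ t ∈ Finset.range k, ∫ ω, s.gap (s.iter (fun i => I i ω) t) ∂P)
      ≤ s.lam * Metric.diam s.C ^ 2 + k * (s.B * (2 * s.η * Lℓ * E + 2 * s.α * E ^ 2))
        + s.η ^ 2 * (s.B * Lℓ ^ 2 / s.α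
          * (∫ ω, s.logDet (fun i => I i ω) k ∂P + 1 / (γ + 1))) := by
  have hn : (n : ℝ) ≠ 0 := by exact_mod_cast (hB₀.trans_le hB).ne'
  have hdep : ∀ t, DependsOnPrefix t fun (I : ℕ → Finset (Fin n)) (j : Fin n) =>
      s.sampleLoss (s.iter I t) j - s.sampleLoss v j := fun t =>
    (s.iter_dependsOnPrefix le_rfl).comp fun w j => s.sampleLoss w j - s.sampleLoss v j
  have hbatch : ∀ t, Integrable (fun ω => ∑ j ∈ I t ω,
      (s.sampleLoss (s.iter (fun i => I i ω) t) j - s.sampleLoss v j)) P := fun t =>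
    hI.integrable (k := t + 1)
      (F := fun I => ∑ j ∈ I t, (s.sampleLoss (s.iter I t) j - s.sampleLoss v j))
      fun I I' h => by
        have h1 := fun j => congrFun (hdep t I I' fun i hi => h i (by omega)) j
        simp only at h1
        simp only [h t (Nat.lt_succ_self t), h1]
  have hlog : Integrable (fun ω => s.logDet (fun i => I i ω) k) P :=
    hI.integrable (s.logDet_dependsOnPrefix k)
  have hmean : ∀ t, ∫ ω, ∑ j ∈ I t ω,
      (s.sampleLoss (s.iter (fun i => I i ω) t) j - s.sampleLoss v j) ∂P
      = s.B * ∫ ω, s.gap (s.iter (fun i => I i ω) t) ∂P := by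
    intro t
    rw [hI.integral_sum_mem hB₀ hB t (hdep t)]
    simp only [hgap]
    rw [integral_const_mul]
    ring
  have hlog' : Integrable (fun ω => s.logDet (fun i => I i ω) k + 1 / (γ + 1)) P :=
    hlog.add (integrable_const _)
  have hrhs : Integrable (fun ω => s.η ^ 2 * (s.B * Lℓ ^ 2 / s.α
      * (s.logDet (fun i => I i ω) k + 1 / (γ + 1)))) P := (hlog'.const_mul _).const_mul _
  -- The batches have size `B` only almost surely.
  have hle := integral_mono_ae (μ := P)
    ((integrable_finsetSum (Finset.range k) fun t _ => hbatch t).const_mul (2 * s.η))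
    ((integrable_const (s.lam * Metric.diam s.C ^ 2
      + k * (s.B * (2 * s.η * Lℓ * E + 2 * s.α * E ^ 2)))).add hrhs) (by
      filter_upwards [ae_all_iff.2 fun t => hI.ae_card_eq hB t] with ω hω
      exact hs.regret_le hα hlam hην hη hv (fun i => I i ω) hγ hγG k hk fun t _ => hω t)
  rw [integral_const_mul, integral_finsetSum _ fun t _ => hbatch t,
    Finset.sum_congr rfl fun t _ => hmean t, ← Finset.mul_sum] at hle
  refine hle.trans_eq ?_
  simp only [Pi.add_apply]
  rw [integral_add (integrable_const _) hrhs, integral_const_mul, integral_const_mul,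
    integral_add hlog (integrable_const _)]
  simp

end Setup

end SGN

/-! ### From the regret bound to the constant `κ` -/

namespace SGN

namespace Setup

variable {d m L n : ℕ} {s : Setup d m L n} {ν Lℓ : ℝ}

theorem gamma_nonneg (hα : 0 < s.α) (hlam : 0 < s.lam) : 0 ≤ s.gamma := by
  have := lipNet_nonneg (σ := s.σ) (C := s.C)
  unfold gamma
  positivity

/-- Equality if `Lip_φ > 0`; if `Lip_φ = 0`, the left side vanishes. -/
theorem mul_gamma_le (hα : 0 < s.α) (hlam : 0 < s.lam) (hB : 0 < s.B) :
    s.α * s.gamma * (s.B * lipNet s.σ s.C ^ 2) ≤ s.lam := by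
  have hB' : (0 : ℝ) < s.B := by exact_mod_cast hB
  rcases (lipNet_nonneg (σ := s.σ) (C := s.C)).eq_or_lt' with h | h
  · rw [h]
    simpa using hlam.le
  · refine le_of_eq ?_
    rw [gamma]
    field_simp

/-- The left side is the cost of averaging; it is the last summand of `κ`, and the other summands
are nonnegative. -/
theorem mul_lipLoss_le_kappa (hα : 0 < s.α) (hlam : 0 < s.lam) (hξ : 0 < s.xi) {D : ℝ}
    (hD : 0 ≤ D) (k : ℕ) :
    Lℓ * (lipGrad s.σ s.C * Metric.diam s.C ^ 2) ≤ s.kappa Lℓ D k := by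
  have h1 := gamma_nonneg hα hlam
  have h2 : 0 ≤ (1 / (k : ℝ)) *
      (lipNet s.σ s.C ^ 2 * Metric.diam s.C ^ 2 * (s.gamma + 2) / s.xi
        + s.xi * Lℓ ^ 2 * (D + 1 / (s.gamma + 1))) := by positivity
  have h3 : 0 ≤ Metric.diam s.C ^ 4 * lipGrad s.σ s.C ^ 2 / s.xi := by positivity
  rw [kappa]
  linarith

theorem kappa_nonneg (hα : 0 < s.α) (hlam : 0 < s.lam) (hξ : 0 < s.xi) {D : ℝ} (hD : 0 ≤ D)
    (hL : 0 ≤ Lℓ) (k : ℕ) : 0 ≤ s.kappa Lℓ D k :=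
  (mul_nonneg hL (mul_nonneg lipGrad_nonneg (sq_nonneg _))).trans
    (mul_lipLoss_le_kappa hα hlam hξ hD k)

/-- Dividing the regret bound by `2 η B k`. -/
theorem mean_le_kappa (hα : 0 < s.α) (hη : 0 < s.η) (hlam : 0 < s.lam) (hB : 0 < s.B)
    (hG : 0 < lipNet s.σ s.C) {D S : ℝ} (hD : 0 ≤ D) {k : ℕ} (hk : 0 < k)
    (h : 2 * s.η * (s.B * S) ≤ s.lam * Metric.diam s.C ^ 2
      + k * (s.B * (2 * s.η * Lℓ * (lipGrad s.σ s.C * Metric.diam s.C ^ 2)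
        + 2 * s.α * (lipGrad s.σ s.C * Metric.diam s.C ^ 2) ^ 2))
      + s.η ^ 2 * (s.B * Lℓ ^ 2 / s.α * (D + 1 / (s.gamma + 1)))) :
    1 / (k : ℝ) * S ≤ s.kappa Lℓ D k := by
  have hB' : (0 : ℝ) < s.B := by exact_mod_cast hB
  have hk' : (0 : ℝ) < k := by exact_mod_cast hk
  have hξ : 0 < s.xi := div_pos hη hα
  have hγ := gamma_nonneg hα hlam
  have hηξ : s.η = s.xi * s.α := by rw [xi, div_mul_cancel₀ _ hα.ne']
  have hlamγ : s.lam = s.gamma * (s.α * lipNet s.σ s.C ^ 2 * s.B) := by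
    rw [gamma, div_mul_cancel₀ _ (by positivity)]
  rw [kappa]
  set ξ := s.xi
  set γ := s.gamma
  set G := lipNet s.σ s.C
  set K := lipGrad s.σ s.C
  set r := Metric.diam s.C
  set T := D + 1 / (γ + 1) with hTdef
  have hT : 0 ≤ T := by positivity
  have h1 : S ≤ γ * G ^ 2 * r ^ 2 / (2 * ξ) + k * (Lℓ * (K * r ^ 2) + (K * r ^ 2) ^ 2 / ξ)
      + ξ * Lℓ ^ 2 * T / 2 := by
    rw [hηξ, hlamγ] at h
    have hpos : 0 < 2 * (ξ * s.α) * s.B := by positivity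
    refine le_of_mul_le_mul_left ?_ hpos
    calc 2 * (ξ * s.α) * s.B * S = 2 * (ξ * s.α) * (s.B * S) := by ring
      _ ≤ _ := h
      _ = _ := by field_simp
  -- The regret bound gives `γ/2` where `κ` has `γ + 2`, and half of the log-determinant term; only
  -- this slack is given away.
  have h2 : γ * G ^ 2 * r ^ 2 / (2 * ξ) ≤ G ^ 2 * r ^ 2 * (γ + 2) / ξ := by
    rw [div_le_div_iff₀ (by positivity) hξ]
    have : 0 ≤ G ^ 2 * r ^ 2 * ξ * (γ + 4) := by positivity
    nlinarith
  have h3 : 0 ≤ ξ * Lℓ ^ 2 * T := by positivity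
  have h4 : S ≤ (G ^ 2 * r ^ 2 * (γ + 2) / ξ + ξ * Lℓ ^ 2 * T)
      + k * (Lℓ * (K * r ^ 2) + (K * r ^ 2) ^ 2 / ξ) := by linarith
  calc 1 / (k : ℝ) * S ≤ 1 / (k : ℝ) * ((G ^ 2 * r ^ 2 * (γ + 2) / ξ + ξ * Lℓ ^ 2 * T)
      + k * (Lℓ * (K * r ^ 2) + (K * r ^ 2) ^ 2 / ξ)) :=
        mul_le_mul_of_nonneg_left h4 (by positivity)
    _ = _ := by
        field_simp
        ring

/-- The gap vanishes on `C` if the predictor is constant there. -/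
theorem gap_eq_zero_of_net_eq {v : Param d m L}
    (hgap : ∀ w, s.gap w = 1 / (n : ℝ) * ∑ j, (s.sampleLoss w j - s.sampleLoss v j))
    {w : Param d m L} (h : ∀ j, net s.σ (s.z j).1 w = net s.σ (s.z j).1 v) : s.gap w = 0 := by
  rw [hgap, Finset.sum_eq_zero fun j _ => by rw [sampleLoss, sampleLoss, h j, sub_self], mul_zero]

theorem regular_of_isRegion {σ₀ σ₁ σ₂ κ₀ ζ₀ r₀ : ℝ} {𝒵 : Set (Sample d)} {β : Set ℝ → ℝ}
    (hR : IsRegion s.σ σ₀ σ₁ σ₂ κ₀ ζ₀ r₀ s.C s.w₀) (hC : Convex ℝ s.C)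
    (hℓ : IsLoss 𝒵 s.loss ν β) (hz : ∀ j, s.z j ∈ 𝒵) (hx : ∀ j, ‖(s.z j).1‖ ≤ 1)
    (hM : 0 < supNet s.σ s.C) :
    s.Regular ν (s.lipLoss β) (lipNet s.σ s.C) (lipGrad s.σ s.C * Metric.diam s.C ^ 2) where
  isCompact := hR.isCompact
  convex := hC
  init_mem := hR.init_mem
  norm_grad_le j _ hw := hR.norm_gradNet_le hw (hx j)
  linearization_le j _ hw _ hv := hR.linearization_le hC hw hv (hx j)
  loss_ge j u v :=
    (hℓ.strongConvex _ (hz j)).add_deriv_mul_sub_add_le (hℓ.differentiable _ (hz j)) u v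
  abs_deriv_loss_le j _ hw :=
    have hu := abs_le.1 (hR.abs_net_le hw (hx j))
    abs_deriv_le_of_abs_sub_le (neg_lt_self hM) hu (hℓ.differentiable _ (hz j) _) fun _ hv =>
      hℓ.lip _ isCompact_Icc _ (hz j) _ hv _ hu

end Setup

end SGN

end

/-! ### The main theorem -/

theorem theorem1 (L : ℕ) (σ₀ σ₁ σ₂ κ₀ ζ₀ r₀ : ℝ) :
    ∃ K : ℝ, 0 ≤ K ∧
      ∀ (d m n : ℕ) (s : SGN.Setup d m L n) (𝒳 : Set (EuclideanSpace ℝ (Fin d))) (𝒴 : Set ℝ)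
        (ν : ℝ) (β : Set ℝ → ℝ)
        (Ω : Type*) [MeasurableSpace Ω] (P : MeasureTheory.Measure Ω)
        [MeasureTheory.IsProbabilityMeasure P] (I : ℕ → Ω → Finset (Fin n)),
        0 < m →
        SGN.IsActivation s.σ σ₀ σ₁ σ₂ →
        -- the loss, and the training set (any realization)
        0 < ν → SGN.IsLoss (𝒳 ×ˢ 𝒴) s.loss ν β →
        (∀ j, s.z j ∈ 𝒳 ×ˢ 𝒴 ∧ ‖(s.z j).1‖ ≤ 1 ∧ |(s.z j).2| ≤ 1) →
        -- the parameter set and the initial parameter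
        IsCompact s.C → Convex ℝ s.C → s.w₀ ∈ s.C →
        SGN.kappaInit s.w₀ ≤ κ₀ → ‖SGN.weightOut s.w₀‖ ≤ ζ₀ → Metric.diam s.C ≤ r₀ →
        -- the mini-batches and the hyperparameters
        0 < s.B → s.B ≤ n → SGN.IsUniformMinibatch P s.B I →
        0 < s.α → 0 < s.lam → 2 / ν ≤ s.xi →
        SGN.lipGrad s.σ s.C ^ 2 ≤ K / m ∧
        ∀ k : ℕ, 0 < k →
          (∀ t < k, MeasureTheory.Integrable (fun ω => s.gap (s.iter (fun i => I i ω) t)) P) ∧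
          MeasureTheory.Integrable (fun ω => s.gap (s.avgIter (fun i => I i ω) k)) P ∧
          MeasureTheory.Integrable (fun ω => s.logDet (fun i => I i ω) k) P ∧
          (1 / (k : ℝ)) * ∑ t ∈ Finset.range k, ∫ ω, s.gap (s.iter (fun i => I i ω) t) ∂P
            ≤ s.kappa (s.lipLoss β) (∫ ω, s.logDet (fun i => I i ω) k ∂P) k ∧
          ∫ ω, s.gap (s.avgIter (fun i => I i ω) k) ∂P
            ≤ 4 * s.kappa (s.lipLoss β) (∫ ω, s.logDet (fun i => I i ω) k ∂P) k
              + 2 * Metric.diam s.C ^ 4 * SGN.lipGrad s.σ s.C ^ 2 := by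
  refine ⟨SGN.hessConst L σ₀ σ₁ σ₂ κ₀ ζ₀ r₀ ^ 2, sq_nonneg _, ?_⟩
  intro d m n s 𝒳 𝒴 ν β Ω _ P _ I hm hσ hν hℓ hz hC hconv hw₀ hκ hζ hr hB₀ hB hI hα hlam hξν
  have hR : SGN.IsRegion s.σ σ₀ σ₁ σ₂ κ₀ ζ₀ r₀ s.C s.w₀ := ⟨hm, hσ, hC, hw₀, hκ, hζ, hr⟩
  have hx : ∀ j, ‖(s.z j).1‖ ≤ 1 := fun j => (hz j).2.1
  refine ⟨hR.sq_lipGrad_le, fun k hk => ?_⟩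
  have hiter : ∀ t, Integrable (fun ω => s.gap (s.iter (fun i => I i ω) t)) P := fun t =>
    hI.integrable ((s.iter_dependsOnPrefix le_rfl).comp s.gap)
  have havg : Integrable (fun ω => s.gap (s.avgIter (fun i => I i ω) k)) P :=
    hI.integrable ((s.avgIter_dependsOnPrefix k).comp s.gap)
  refine ⟨fun t _ => hiter t, havg, hI.integrable (s.logDet_dependsOnPrefix k), ?_⟩
  have hξ : 0 < s.xi := (div_pos two_pos hν).trans_le hξν
  have hη : 0 < s.η := by
    have := mul_pos hξ hα
    rwa [SGN.Setup.xi, div_mul_cancel₀ _ hα.ne'] at this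
  have hην : 2 * s.α ≤ s.η * ν := by
    rwa [SGN.Setup.xi, div_le_div_iff₀ hν hα] at hξν
  have hD : 0 ≤ ∫ ω, s.logDet (fun i => I i ω) k ∂P :=
    integral_nonneg fun ω => SGN.Setup.logDet_nonneg hα hlam _ k
  have hLℓ : 0 ≤ s.lipLoss β := (hℓ.lip_pos _ isCompact_Icc).le
  have hrest : 0 ≤ 2 * Metric.diam s.C ^ 4 * SGN.lipGrad s.σ s.C ^ 2 := by positivity
  have hκ0 := SGN.Setup.kappa_nonneg hα hlam hξ hD hLℓ k
  obtain ⟨v, hv, hgap⟩ := SGN.Setup.exists_gap_eq hC hw₀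
    (fun j => (hR.jetBound hw₀ (hx j)).contDiff.continuous)
    (fun j => (hℓ.differentiable _ (hz j).1).continuous)
  -- If the predictor is constant on `C` at all training inputs, every gap is zero. Otherwise `Lip_φ
  -- > 0`, so `λ = γ α Lip_φ² B` holds, and `M > 0`, so `[-M, M]` is nondegenerate and `Lip_ℓ`
  -- bounds the derivatives of the loss.
  by_cases htriv : ∀ w ∈ s.C, ∀ j, SGN.net s.σ (s.z j).1 w = SGN.net s.σ (s.z j).1 v
  · have hgap0 : ∀ w ∈ s.C, s.gap w = 0 := fun w hw =>
      SGN.Setup.gap_eq_zero_of_net_eq hgap (htriv w hw)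
    have hiter0 : ∀ ω t, s.gap (s.iter (fun i => I i ω) t) = 0 := fun ω t =>
      hgap0 _ (SGN.Setup.iter_mem hC hw₀ _ t)
    have havg0 : ∀ ω, s.gap (s.avgIter (fun i => I i ω) k) = 0 := fun ω =>
      hgap0 _ (SGN.Setup.avgIter_mem hC hconv hw₀ _ hk)
    simp only [hiter0, havg0, integral_zero, Finset.sum_const_zero, mul_zero]
    exact ⟨hκ0, by linarith⟩
  · have hG : 0 < SGN.lipNet s.σ s.C := SGN.lipNet_nonneg.lt_of_ne' fun h0 =>
      htriv fun w hw j => hR.net_eq_of_lipNet_eq_zero hconv h0 hv hw (hx j)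
    have hM : 0 < SGN.supNet s.σ s.C := SGN.supNet_nonneg.lt_of_ne' fun h0 =>
      htriv fun w hw j => by
        have hnet : ∀ w ∈ s.C, SGN.net s.σ (s.z j).1 w = 0 := fun w hw =>
          abs_nonpos_iff.1 (h0 ▸ hR.abs_net_le hw (hx j))
        rw [hnet w hw, hnet v hv]
    have hs := SGN.Setup.regular_of_isRegion hR hconv hℓ (fun j => (hz j).1) hx hM
    have hmean := SGN.Setup.mean_le_kappa hα hη hlam hB₀ hG hD hk
      (hs.sum_integral_gap_le hI hB₀ hB hv hgap hα hlam hην hη (SGN.Setup.gamma_nonneg hα hlam)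
        (SGN.Setup.mul_gamma_le hα hlam hB₀) hk)
    refine ⟨hmean, ?_⟩
    have hle := integral_mono (μ := P) havg
      (((integrable_finsetSum (Finset.range k) fun t _ => hiter t).const_mul (1 / (k : ℝ))).add
        (integrable_const (s.lipLoss β * (SGN.lipGrad s.σ s.C * Metric.diam s.C ^ 2))))
      fun ω => hs.gap_avgIter_le hν.le (hB₀.trans_le hB) (fun i => I i ω) hk
    simp only [Pi.add_apply] at hle
    rw [integral_add ((integrable_finsetSum (Finset.range k) fun t _ => hiter t).const_mul _)
      (integrable_const _), integral_const_mul, integral_finsetSum _ fun t _ => hiter t,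
      integral_const, probReal_univ, one_smul] at hle
    have hκE := SGN.Setup.mul_lipLoss_le_kappa (Lℓ := s.lipLoss β) hα hlam hξ hD k
    -- The mean gap and the cost of averaging are each at most `κ`, and `κ` is nonnegative.
    linarith
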